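/- **Setting.** Let $n,m\in\mathbb N$ and let $\mathbb J=\mathbb R^T$ be the jet space with coordinates $Y=\{x_1,\dots,x_n\}\cup U$, $U=\{u^i_\alpha : 1\le i\le m,\ \alpha\in\mathbb N^n\}$, and the product topology. For an open set $V\subset\mathbb R^T$ (any $T$), $\mathcal F(V)$ is the algebra of functions $V\to\mathbb R$ that depend on finitely many coordinates and are $C^\infty$ in them. A function $f\in\mathcal F(V)$ *depends on* $y\in Y$ if $\partial f/\partial y\not\equiv0$ on $V$. Put $D_if=\partial f/\partial x_i+\sum_{j,\alpha}(\partial f/\partial u^j_\alpha)\,u^j_{\alpha+e_i}$ and $D^\alpha=D_1^{\alpha_1}\cdots D_n^{\alpha_n}$. The orbit of $S\subset\mathcal F(V)$ is $O(S)=\{D^\alpha f: f\in S,\alpha\in\mathbb N^n\}$, and $\langle\langle S\rangle\rangle$ is the ideal of $\mathcal F(V)$ generated by $O(S)$; the orbit of a set $P\subset U$ is $O(P)=\{u^i_{\alpha+\delta}: u^i_\alpha\in P,\ \delta\in\mathbb N^n\}$. For $P\subset Y$ we say that $f$ is *polynomial in $P$* if $f$ is a polynomial in finitely many variables from $P$ with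 coefficients in $\mathcal F(V)$ that depend on no variable from $P$. A set $B\subset\mathcal F(V)$ is *normalized* with set of principal variables $L\subset Y$ if every $f\in B$ can be written $f=y_f+g_f$ with $y_f\in L$ and $g_f$ depending on no element of $L$, and $f\mapsto y_f$ is a bijection $B\to L$. A *differential system* on $V$ is a set $S\subset\mathcal F(V)$ each of whose elements depends on some $u^i_\alpha$ with $\alpha\ne0$. *Stratification.* Let $\Gamma$ be a well-ordered set and $U=\bigsqcup_{\gamma\in\Gamma}U_\gamma$ a partition. For $u\in U_\gamma$, $v\in U_{\gamma'}$ write $u\prec v$ if $\gamma<\gamma'$ and $u\preceq v$ if $\gamma\le\gamma'$. Assume that, for the action $\delta u^i_\alpha=u^i_{\alpha+\delta}$ and all $\delta\in\mathbb N^n$: if $u,v$ lie in one block, so do $\delta u,\delta v$; $u\prec v$ implies $\delta u\prec\delta v$; and $u\prec\delta u$ if $\delta\neq0$. For $g,h\in\mathcal F(V)$ write $g\prec u$ if every $v\in U$ on which $g$ depends satisfies $v\prec u$, and $g\preceq h$ if for every $v\in U$ on which $g$ depends there is $w\in U$ on which $h$ depends with $v\preceq w$. A function $f=u+g$ with $u\in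 U$, $g\prec u$ is *orderly solvable* with *leading term* $\operatorname{lt}f=u$. A set $S$ is *weakly solvable* if all its elements are orderly solvable; then $\operatorname{lt}S=\{\operatorname{lt}f:f\in S\}$. *Reduction.* Let $S$ be weakly solvable and $f\in S$. A function $F\in\mathcal F(V)$ reduces to $r\in\mathcal F(V)$ modulo $f$ if for some $\delta\in\mathbb N^n$, with $v=\delta\operatorname{lt}f$, $F$ is polynomial in $\{v\}$ and $F=q\,D^\delta f+r$ for some $q\in\mathcal F(V)$, where $r$ does not depend on $v$, $q\preceq F$ and $r\preceq F$. And $F$ reduces to $r$ modulo $S$ if $F$ is polynomial in $O(\operatorname{lt}S)$ and finitely many reductions modulo elements of $S$ lead from $F$ to $r$. For $f_1,f_2\in S$ with $\operatorname{lt}f_1=u^i_\alpha$, $\operatorname{lt}f_2=u^i_\beta$ let $\tau(f_1,f_2)=D^{\max(\alpha,\beta)-\alpha}f_1-D^{\max(\alpha,\beta)-\beta}f_2$ (componentwise maximum). $S$ satisfies the *reducibility conditions on $V$* if $\tau(f_1,f_2)$ reduces to $0$ modulo $S$ for every such pair. *Passivity.* $S$ is *passive on $V$* if every $f\in S$ has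 the form $f=\operatorname{lt}f+g$ with $g$ depending on no element of $O(\operatorname{lt}f)$, and $\langle\langle S\rangle\rangle$ is a proper ideal generated by a normalized set whose set of principal variables is exactly $O(\operatorname{lt}S)$. A set $M\subset\mathbb R^T$ is a *smooth manifold* if each $a\in M$ has an open neighbourhood $N$ with a diffeomorphism $\phi$ of $N$ onto an open set $N'\subset\mathbb R^T$ (a homeomorphism such that all components of $\phi$ and $\phi^{-1}$ lie in $\mathcal F(N)$ and $\mathcal F(N')$ respectively) and $\phi(N\cap M)=N'\cap\{z: z_t=0\ \forall t\in T'\}$ for some $T'\subset T$. **Theorem 5.2.** Let $V\subset\mathbb J$ be open and let $S=\{f_1,\dots,f_k\}\subset\mathcal F(V)$ be a finite, weakly solvable differential system that is a normalized set and satisfies the reducibility conditions on $V$. Then: 1. the set $\mathcal M=\{z\in V: f(z)=0\ \text{for all } f\in O(S)\}$ is a smooth manifold in $\mathbb J$; 2. $S$ is passive on $V$, provided that one of the following holds: (a) $V\neq\emptyset$ and $V=W\times\mathbb R^{O(\operatorname{lt}S)}$ for some set $W\subset\mathbb R^{Y\setminus O(\operatorname{lt}S)}$, i.e. membership of a point in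 $V$ is not affected by changing its coordinates in $O(\operatorname{lt}S)$; (b) $\mathcal M\ne\emptyset$ and every $f\in S$ is polynomial in $O(\operatorname{lt}S)$. -/

import Mathlib

open scoped ContDiff

/-! ### Smooth functions of finitely many variables on open subsets of `ℝ^T`

`T → ℝ` carries the product topology. -/

/-- The algebra `𝓕(V)` of functions on `V` that depend on finitely many coordinates (those in a
finite set `s`) and are smooth as functions of these. (The projection of an open set to `ℝ^s` is
open, so being `C^∞` at each of its points is being smooth on it.) -/
def smoothFunctions {T : Type*} (V : TopologicalSpace.Opens (T → ℝ)) : Subalgebra ℝ (V → ℝ) where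
  carrier := {f | ∃ (s : Finset T) (F : (s → ℝ) → ℝ),
    ∀ z : V, ContDiffAt ℝ ∞ F (s.restrict z.1) ∧ f z = F (s.restrict z.1)}
  mul_mem' := by
    classical
    rintro f g ⟨s, F, hF⟩ ⟨s', G, hG⟩
    refine ⟨s ∪ s', fun w => F (fun i => w ⟨i.1, Finset.mem_union_left _ i.2⟩) *
      G (fun i => w ⟨i.1, Finset.mem_union_right _ i.2⟩), fun z => ⟨?_, ?_⟩⟩
    · refine ContDiffAt.mul ?_ ?_
      · exact ContDiffAt.comp _ (hF z).1 (contDiff_pi.2 fun i => contDiff_apply ℝ ℝ _).contDiffAt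
      · exact ContDiffAt.comp _ (hG z).1 (contDiff_pi.2 fun i => contDiff_apply ℝ ℝ _).contDiffAt
    · exact congrArg₂ (· * ·) (hF z).2 (hG z).2
  add_mem' := by
    classical
    rintro f g ⟨s, F, hF⟩ ⟨s', G, hG⟩
    refine ⟨s ∪ s', fun w => F (fun i => w ⟨i.1, Finset.mem_union_left _ i.2⟩) +
      G (fun i => w ⟨i.1, Finset.mem_union_right _ i.2⟩), fun z => ⟨?_, ?_⟩⟩
    · refine ContDiffAt.add ?_ ?_
      · exact ContDiffAt.comp _ (hF z).1 (contDiff_pi.2 fun i => contDiff_apply ℝ ℝ _).contDiffAt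
      · exact ContDiffAt.comp _ (hG z).1 (contDiff_pi.2 fun i => contDiff_apply ℝ ℝ _).contDiffAt
    · exact congrArg₂ (· + ·) (hF z).2 (hG z).2
  algebraMap_mem' := fun c => ⟨∅, fun _ => c, fun _ => ⟨contDiffAt_const, rfl⟩⟩

/-- The coordinate function `y_t` on `V`. -/
def coordFun {T : Type*} (V : TopologicalSpace.Opens (T → ℝ)) (t : T) : smoothFunctions V :=
  ⟨fun z => z.1 t, {t}, fun w => w ⟨t, Finset.mem_singleton_self t⟩,
    fun _ => ⟨(contDiff_apply ℝ ℝ _).contDiffAt, rfl⟩⟩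

open Classical in
/-- The value at `z` of the partial derivative `∂f/∂y_t` of a function on `V`. -/
noncomputable def partialAt {T : Type*} {V : TopologicalSpace.Opens (T → ℝ)} (t : T) (f : V → ℝ)
    (z : V) : ℝ :=
  deriv (fun r : ℝ => if h : Function.update z.1 t r ∈ V then f ⟨_, h⟩ else 0) (z.1 t)

open Classical in
theorem partialAt_eq {T : Type*} {V : TopologicalSpace.Opens (T → ℝ)} (t : T) (f : V → ℝ)
    (s : Finset T) (F : (s → ℝ) → ℝ)
    (hF : ∀ z : V, ContDiffAt ℝ ∞ F (s.restrict z.1) ∧ f z = F (s.restrict z.1)) (z : V) :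
    partialAt t f z = fderiv ℝ F (s.restrict z.1) (fun i => if i.1 = t then 1 else 0) := by
  have hcont : Continuous (fun r : ℝ => Function.update z.1 t r) :=
    continuous_const.update t continuous_id
  have hmem : ∀ᶠ r in nhds (z.1 t), Function.update z.1 t r ∈ V := by
    apply hcont.continuousAt.eventually_mem
    rw [Function.update_eq_self]
    exact V.isOpen.mem_nhds z.2
  have hcurve : HasDerivAt (fun r : ℝ => s.restrict (Function.update z.1 t r))
      (fun i => if i.1 = t then 1 else 0) (z.1 t) := by
    rw [hasDerivAt_pi]
    intro i
    by_cases hi : i.1 = t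
    · have : (fun r : ℝ => s.restrict (Function.update z.1 t r) i) = fun r => r := by
        funext r; simp [Finset.restrict, hi]
      rw [this]; simpa [hi] using hasDerivAt_id' (z.1 t)
    · have : (fun r : ℝ => s.restrict (Function.update z.1 t r) i) = fun r => z.1 i := by
        funext r; simp [Finset.restrict, hi]
      rw [this]; simpa [hi] using hasDerivAt_const (z.1 t) (z.1 i)
  have hFd : HasFDerivAt F (fderiv ℝ F (s.restrict z.1))
      (s.restrict (Function.update z.1 t (z.1 t))) := by
    rw [Function.update_eq_self]
    exact ((hF z).1.differentiableAt (by simp)).hasFDerivAt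
  have h := hFd.comp_hasDerivAt (z.1 t) hcurve
  refine (h.congr_of_eventuallyEq ?_).deriv
  filter_upwards [hmem] with r hr
  simp only [hr, dif_pos, Function.comp]
  exact (hF ⟨_, hr⟩).2

/-- The partial derivative `∂/∂y_t` on the algebra `𝓕(V)`. -/
noncomputable def partialDeriv {T : Type*} {V : TopologicalSpace.Opens (T → ℝ)} (t : T)
    (f : smoothFunctions V) : smoothFunctions V :=
  ⟨partialAt t f.1, by
    classical
    obtain ⟨s, F, hF⟩ := f.2
    refine ⟨s, fun w => fderiv ℝ F w (fun i => if i.1 = t then 1 else 0), fun z => ⟨?_, ?_⟩⟩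
    · exact ((hF z).1.fderiv_right (m := ∞) (by simp)).clm_apply contDiffAt_const
    · exact partialAt_eq t f.1 s F hF z⟩

/-- `f` depends on `y_t`, that is `y_t ∈ iv f`: `∂f/∂y_t` does not vanish identically on `V`. -/
def DependsOnVar {T : Type*} {V : TopologicalSpace.Opens (T → ℝ)} (f : smoothFunctions V) (t : T) :
    Prop :=
  partialDeriv t f ≠ 0

/-- An element of `𝓕(V)` depends on finitely many variables; so the sum defining a total
derivative below is finite. -/
theorem finite_dependsOnVar {T : Type*} {V : TopologicalSpace.Opens (T → ℝ)} (f : smoothFunctions V) :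
    {t | DependsOnVar f t}.Finite := by
  classical
  obtain ⟨s, F, hF⟩ := f.2
  refine s.finite_toSet.subset fun t ht => ?_
  by_contra hts
  refine ht (Subtype.ext (funext fun z => ?_))
  refine (partialAt_eq t f.1 s F hF z).trans ?_
  have : (fun i : s => if i.1 = t then (1 : ℝ) else 0) = 0 := by
    funext i
    have : i.1 ≠ t := fun h => hts (h ▸ i.2)
    simp [this]
  rw [this, map_zero]
  rfl

/-- `B ⊆ 𝓕(V)` is a normalized set with set of principal variables `L`: every `f ∈ B` is
`y_{t f} + g` with `t f ∈ L` and `g` not depending on the variables in `L`, where `f ↦ t f` is a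
bijection of `B` onto `L`. -/
def IsNormalizedWith {T : Type*} {V : TopologicalSpace.Opens (T → ℝ)} (B : Set (smoothFunctions V))
    (L : Set T) : Prop :=
  ∃ t : smoothFunctions V → T, Set.BijOn t B L ∧
    ∀ f ∈ B, ∀ l ∈ L, ¬ DependsOnVar (f - coordFun V (t f)) l

/-- `B ⊆ 𝓕(V)` is a normalized set. -/
def IsNormalized {T : Type*} {V : TopologicalSpace.Opens (T → ℝ)} (B : Set (smoothFunctions V)) :
    Prop :=
  ∃ L, IsNormalizedWith B L

/-- `f` is a polynomial in the variables `y_t`, `t ∈ P`, whose coefficients are elements of `𝓕(V)`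
that depend on none of these variables. -/
def IsPolynomialIn {T : Type*} {V : TopologicalSpace.Opens (T → ℝ)} (P : Set T)
    (f : smoothFunctions V) : Prop :=
  f ∈ Algebra.adjoin ℝ
    ({c : smoothFunctions V | ∀ t ∈ P, ¬ DependsOnVar c t} ∪ coordFun V '' P)

/-- `M ⊆ ℝ^T` is a smooth (embedded) manifold: near each of its points some diffeomorphism between
open subsets of `ℝ^T` carries `M` onto a coordinate subspace `{z | z t = 0 for t ∈ T'}`. -/
def IsSmoothManifold {T : Type*} (M : Set (T → ℝ)) : Prop :=
  ∀ a ∈ M, ∃ e : OpenPartialHomeomorph (T → ℝ) (T → ℝ), a ∈ e.source ∧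
    (∀ t, (fun z : e.source => e z.1 t) ∈ smoothFunctions ⟨e.source, e.open_source⟩) ∧
    (∀ t, (fun z : e.target => e.symm z.1 t) ∈ smoothFunctions ⟨e.target, e.open_target⟩) ∧
    ∃ T' : Set T, e '' (e.source ∩ M) = e.target ∩ {z | ∀ t ∈ T', z t = 0}

/-! ### The jet space -/

/-- Index set of the variables `u^i_α`, `i = 1, …, m`, `α ∈ ℕ^n`. -/
abbrev JetVar (n m : ℕ) := Fin m × (Fin n → ℕ)

/-- Index set of all coordinates `x_1, …, x_n`, `u^i_α` of the jet space. -/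
abbrev JetIndex (n m : ℕ) := Fin n ⊕ JetVar n m

/-- The jet space `𝕁`, with the product topology. -/
abbrev JetSpace (n m : ℕ) := JetIndex n m → ℝ

/-- The action of `ℕ^n` on the variables: `δ u^i_α = u^i_{α+δ}`. -/
def shiftVar {n m : ℕ} (δ : Fin n → ℕ) (u : JetVar n m) : JetVar n m := (u.1, u.2 + δ)

/-- The orbit of a set of variables `u^i_α` under `ℕ^n`. -/
def varOrbit {n m : ℕ} (P : Set (JetVar n m)) : Set (JetVar n m) :=
  {v | ∃ u ∈ P, ∃ δ, v = shiftVar δ u}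

/-- `D_i` of the coordinate functions: `D_i x_k = δ_{ik}`, `D_i u^j_α = u^j_{α+e_i}`. -/
noncomputable def totalDerivCoord {n m : ℕ} (V : TopologicalSpace.Opens (JetSpace n m)) (i : Fin n) :
    JetIndex n m → smoothFunctions V
  | Sum.inl k => if k = i then 1 else 0
  | Sum.inr u => coordFun V (Sum.inr (shiftVar (Pi.single i 1) u))

/-- The total derivative `D_i f = ∂f/∂x_i + ∑ (∂f/∂u^j_α) u^j_{α+e_i}` (a finite sum). -/
noncomputable def totalDeriv {n m : ℕ} {V : TopologicalSpace.Opens (JetSpace n m)} (i : Fin n)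
    (f : smoothFunctions V) : smoothFunctions V :=
  ∑ᶠ t : JetIndex n m, partialDeriv t f * totalDerivCoord V i t

/-- `D^α = D_1^{α_1} ⋯ D_n^{α_n}`. -/
noncomputable def totalDerivMulti {n m : ℕ} {V : TopologicalSpace.Opens (JetSpace n m)}
    (α : Fin n → ℕ) (f : smoothFunctions V) : smoothFunctions V :=
  (List.finRange n).foldr (fun i g => (totalDeriv i)^[α i] g) f

/-- The orbit `O(S) = {D^α f | f ∈ S, α ∈ ℕ^n}`. -/
def diffOrbit {n m : ℕ} {V : TopologicalSpace.Opens (JetSpace n m)} (S : Set (smoothFunctions V)) :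
    Set (smoothFunctions V) :=
  {h | ∃ f ∈ S, ∃ α, h = totalDerivMulti α f}

/-- The zero set in `V` of the orbit `O(S)`, as a subset of the jet space. -/
def orbitZeroSet {n m : ℕ} {V : TopologicalSpace.Opens (JetSpace n m)}
    (S : Set (smoothFunctions V)) : Set (JetSpace n m) :=
  {z | ∃ hz : z ∈ V, ∀ f ∈ diffOrbit S, f.1 ⟨z, hz⟩ = 0}

/-- `S ⊆ 𝓕(V)` is a differential system: every `f ∈ S` depends on some `u^i_α` with `α ≠ 0`. -/
def IsDifferentialSystem {n m : ℕ} {V : TopologicalSpace.Opens (JetSpace n m)}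
    (S : Set (smoothFunctions V)) : Prop :=
  ∀ f ∈ S, ∃ u : JetVar n m, u.2 ≠ 0 ∧ DependsOnVar f (Sum.inr u)

/-- `f = u + g` is solvable with respect to the variable `u = u^i_α`: `g` does not depend on the
elements of the orbit of `u`. -/
def IsSolvableFor {n m : ℕ} {V : TopologicalSpace.Opens (JetSpace n m)} (f : smoothFunctions V)
    (u : JetVar n m) : Prop :=
  ∀ δ, ¬ DependsOnVar (f - coordFun V (Sum.inr u)) (Sum.inr (shiftVar δ u))

/-- `S` is passive on `V`, the function `f ∈ S` being solvable with respect to `st f`: the ideal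
`⟨⟨S⟩⟩` generated by the orbit of `S` is soft (proper, and generated by a normalized set), with a
normalized system of generators whose principal variables are exactly the orbit of
`{st f | f ∈ S}`. -/
def IsPassive {n m : ℕ} {V : TopologicalSpace.Opens (JetSpace n m)} (S : Set (smoothFunctions V))
    (st : smoothFunctions V → JetVar n m) : Prop :=
  (∀ f ∈ S, IsSolvableFor f (st f)) ∧
  Ideal.span (diffOrbit S) ≠ ⊤ ∧
  ∃ B : Set (smoothFunctions V),
    IsNormalizedWith B (Sum.inr '' varOrbit (st '' S)) ∧ Ideal.span B = Ideal.span (diffOrbit S)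

/-! ### Stratifications and reductions -/

/-- The partition of the set of variables `u^i_α` into the blocks `U_γ = {u | lvl u = γ}` makes it
a stratified `ℕ^n`-set. Here `u ≺ v` means `lvl u < lvl v`. -/
structure IsStratification {n m : ℕ} {Γ : Type*} [LinearOrder Γ] (lvl : JetVar n m → Γ) : Prop where
  same_block : ∀ δ u v, lvl u = lvl v → lvl (shiftVar δ u) = lvl (shiftVar δ v)
  strictMono : ∀ δ u v, lvl u < lvl v → lvl (shiftVar δ u) < lvl (shiftVar δ v)
  lt_shift : ∀ δ u, δ ≠ 0 → lvl u < lvl (shiftVar δ u)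

/-- `g ≺ u`: all variables `u^j_β` on which `g` depends lie in lower blocks than `u` (in particular
this holds when `g` depends on `x_1, …, x_n` only). -/
def PrecVar {n m : ℕ} {Γ : Type*} [LinearOrder Γ] {V : TopologicalSpace.Opens (JetSpace n m)}
    (lvl : JetVar n m → Γ) (g : smoothFunctions V) (u : JetVar n m) : Prop :=
  ∀ v, DependsOnVar g (Sum.inr v) → lvl v < lvl u

/-- `g ⪯ h`: the highest block met by the variables of `g` is not above the highest block met by
those of `h`. Functions of `x_1, …, x_n` alone are below everything. -/
def PrecEq {n m : ℕ} {Γ : Type*} [LinearOrder Γ] {V : TopologicalSpace.Opens (JetSpace n m)}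
    (lvl : JetVar n m → Γ) (g h : smoothFunctions V) : Prop :=
  ∀ u, DependsOnVar g (Sum.inr u) → ∃ v, DependsOnVar h (Sum.inr v) ∧ lvl u ≤ lvl v

/-- `f = u + g` is orderly solvable with respect to `u`, its leading term: `g ≺ u`. -/
def IsOrderlySolvable {n m : ℕ} {Γ : Type*} [LinearOrder Γ]
    {V : TopologicalSpace.Opens (JetSpace n m)}
    (lvl : JetVar n m → Γ) (f : smoothFunctions V) (u : JetVar n m) : Prop :=
  PrecVar lvl (f - coordFun V (Sum.inr u)) u

/-- `F` reduces to `r` modulo `f`, a function with leading term `u`: for some `v = δ u`, `F` is a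
polynomial in `v` with coefficients not depending on `v`, and `F = q D^δ f + r` where `r` does not
depend on `v` and `q ⪯ F`, `r ⪯ F`. -/
def ReducesByFunction {n m : ℕ} {Γ : Type*} [LinearOrder Γ]
    {V : TopologicalSpace.Opens (JetSpace n m)}
    (lvl : JetVar n m → Γ) (f : smoothFunctions V) (u : JetVar n m) (F r : smoothFunctions V) :
    Prop :=
  ∃ (δ : Fin n → ℕ) (q : smoothFunctions V),
    IsPolynomialIn {Sum.inr (shiftVar δ u)} F ∧
    F = q * totalDerivMulti δ f + r ∧
    ¬ DependsOnVar r (Sum.inr (shiftVar δ u)) ∧ PrecEq lvl q F ∧ PrecEq lvl r F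

/-- `F` reduces to `r` modulo `S`, where `lt f` is the leading term of `f ∈ S`: `F` is a polynomial
in the orbit of the leading terms with coefficients depending only on the other variables, and
finitely many reductions modulo elements of `S` lead from `F` to `r`. -/
def Reduces {n m : ℕ} {Γ : Type*} [LinearOrder Γ] {V : TopologicalSpace.Opens (JetSpace n m)}
    (lvl : JetVar n m → Γ) (S : Set (smoothFunctions V)) (lt : smoothFunctions V → JetVar n m)
    (F r : smoothFunctions V) : Prop :=
  IsPolynomialIn (Sum.inr '' varOrbit (lt '' S)) F ∧
  Relation.ReflTransGen (fun G G' => ∃ f ∈ S, ReducesByFunction lvl f (lt f) G G') F r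

/-- `τ(f₁, f₂) = D^{α ⋄ β} f₁ - D^{β ⋄ α} f₂` with `(α ⋄ β)_i = max(α_i, β_i) - α_i`. -/
noncomputable def tauDiff {n m : ℕ} {V : TopologicalSpace.Opens (JetSpace n m)}
    (α β : Fin n → ℕ) (f₁ f₂ : smoothFunctions V) : smoothFunctions V :=
  totalDerivMulti (fun i => max (α i) (β i) - α i) f₁ -
    totalDerivMulti (fun i => max (β i) (α i) - β i) f₂

/-- The reducibility conditions on `V`: `τ(f₁, f₂)` reduces to `0` modulo `S` for all
`f₁, f₂ ∈ S` with leading terms `u^i_α`, `u^i_β` (the same `i`). -/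
def SatisfiesReducibility {n m : ℕ} {Γ : Type*} [LinearOrder Γ]
    {V : TopologicalSpace.Opens (JetSpace n m)} (lvl : JetVar n m → Γ)
    (S : Set (smoothFunctions V)) (lt : smoothFunctions V → JetVar n m) : Prop :=
  ∀ f₁ ∈ S, ∀ f₂ ∈ S, (lt f₁).1 = (lt f₂).1 →
    Reduces lvl S lt (tauDiff (lt f₁).2 (lt f₂).2 f₁ f₂) 0

/-!
Let `P` be the orbit of the leading terms. For `v ∈ P` choose one element `F v = v + g_v`, `g_v ≺ v`,
of the orbit of `S` with leading term `v`. A nonzero multiple of `D^δ f` subtracted in a reduction of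
`F` has a leading term that is not above the variables of `F`, so the reducibility conditions say
that `τ(f₁, f₂)` is a combination of elements of the orbit with leading terms strictly below
`u^i_{max(α, β)}` (`Reduces.mem_lowerIdeal`). Total derivatives commute and respect the
stratification; hence two elements of the orbit with the same leading term `v` differ by a
combination of elements with leading terms below `v` (`sub_mem_lowerIdeal_of_shiftVar_eq`), and by
induction on the level the `F v` generate the ideal `⟨⟨S⟩⟩` (`exists_triangular_generators`). So the
orbit of `S` may be replaced by a triangular system.

The zero set of a triangular system is a manifold: near a point, on a box on which independence in
the sense of partial derivatives is actual independence, `z_v ↦ F v` is a change of coordinates that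
is inverted by recursion on the level (`isSmoothManifold_of_triangular`).

For passivity the equations are solved one level after another. If the variables of `P` can be
eliminated from `g_v` by means of equations `y_w = h_w`, `w ≺ v`, in which `h_w` does not depend on
`P`, then recursion yields generators `y_v - h_v` of `⟨⟨S⟩⟩` (`exists_normalized_generators`). On a
domain `W × ℝ^P` elimination is possible by Hadamard's lemma (`IsSaturated.exists_sub_mem`), and
these generators visibly have a common zero, so that the ideal is proper. In the polynomial case
total derivatives of elements of `S` are again polynomial in `P`, a polynomial involves only those
variables of `P` on which it depends (`IsPolynomialIn.mem_adjoin`), and elimination is substitution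
(`exists_sub_mem_of_mem_adjoin`); here the ideal is proper because the zero set is not empty.
-/

/-! ### The algebra of smooth functions of finitely many variables -/

section SmoothFunctions

variable {T : Type*} {V : TopologicalSpace.Opens (T → ℝ)}

/-- Composition with a map all of whose components are smooth functions of finitely many
variables preserves smooth functions of finitely many variables. -/
theorem comp_mem_smoothFunctions {T' : Type*} {W : TopologicalSpace.Opens (T' → ℝ)}
    (ψ : W → V) (hψ : ∀ t, (fun z => (ψ z).1 t) ∈ smoothFunctions W) {f : V → ℝ}
    (hf : f ∈ smoothFunctions V) : (fun z => f (ψ z)) ∈ smoothFunctions W := by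
  classical
  obtain ⟨s, F, hF⟩ := hf
  choose σ G hG using hψ
  have hsub : ∀ t : s, ∀ i, i ∈ σ t → i ∈ s.biUnion σ := fun t i hi =>
    Finset.mem_biUnion.2 ⟨t, t.2, hi⟩
  refine ⟨s.biUnion σ, fun w => F fun t => G t fun i => w ⟨i.1, hsub t i.1 i.2⟩,
    fun z => ⟨?_, ?_⟩⟩
  · have key : s.restrict (ψ z).1 = fun t : s => G t.1 ((σ t.1).restrict z.1) :=
      funext fun t => (hG t z).2
    refine ContDiffAt.comp (g := F) _ ?_ ?_
    · have := (hF (ψ z)).1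
      rw [key] at this
      exact this
    · refine contDiffAt_pi.2 fun t => ?_
      exact ContDiffAt.comp (g := G t) _ (hG t z).1
        (contDiff_pi.2 fun i => contDiff_apply ℝ ℝ _).contDiffAt
  · have key : s.restrict (ψ z).1 = fun t : s => G t.1 ((σ t.1).restrict z.1) :=
      funext fun t => (hG t z).2
    change f (ψ z) = _
    rw [(hF (ψ z)).2, key]
    rfl

theorem continuous_of_mem_smoothFunctions {f : V → ℝ} (hf : f ∈ smoothFunctions V) :
    Continuous f := by
  obtain ⟨s, F, hF⟩ := hf
  rw [continuous_iff_continuousAt]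
  intro z
  have : f = F ∘ fun z : V => s.restrict z.1 := funext fun z => (hF z).2
  rw [this]
  refine ContinuousAt.comp (hF z).1.continuousAt ?_
  exact (continuous_pi fun i => (continuous_apply i.1).comp continuous_subtype_val).continuousAt

open Classical in
/-- The restriction of `f` to the line through `z` in direction `t`, extended by zero. -/
noncomputable def sliceAt (t : T) (f : V → ℝ) (z : T → ℝ) (r : ℝ) : ℝ :=
  if h : Function.update z t r ∈ V then f ⟨_, h⟩ else 0

open Classical in
theorem hasDerivAt_sliceAt (t : T) (f : smoothFunctions V) (z : T → ℝ) (r : ℝ)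
    (h : Function.update z t r ∈ V) :
    HasDerivAt (sliceAt t f.1 z) (partialAt t f.1 ⟨_, h⟩) r := by
  have hslice : sliceAt t f.1 (Function.update z t r) = sliceAt t f.1 z := by
    funext r'
    simp [sliceAt]
  suffices hd : DifferentiableAt ℝ (sliceAt t f.1 (Function.update z t r)) r by
    have h1 : partialAt t f.1 ⟨_, h⟩
        = deriv (sliceAt t f.1 (Function.update z t r)) (Function.update z t r t) := rfl
    rw [Function.update_self] at h1
    rw [h1, ← hslice]
    exact hd.hasDerivAt
  rw [hslice]
  obtain ⟨s, F, hF⟩ := f.2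
  have hcont : Continuous (fun r : ℝ => Function.update z t r) :=
    continuous_const.update t continuous_id
  have hmem : ∀ᶠ r' in nhds r, Function.update z t r' ∈ V :=
    hcont.continuousAt.eventually_mem (V.isOpen.mem_nhds h)
  have hd : DifferentiableAt ℝ (fun r' => F (s.restrict (Function.update z t r'))) r := by
    refine DifferentiableAt.comp (g := F) r ((hF ⟨_, h⟩).1.differentiableAt (by simp)) ?_
    rw [differentiableAt_pi]
    intro i
    by_cases hi : i.1 = t
    · have : (fun r : ℝ => s.restrict (Function.update z t r) i) = fun r => r := by
        funext r; simp [Finset.restrict, hi]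
      rw [this]; exact differentiableAt_id
    · have : (fun r : ℝ => s.restrict (Function.update z t r) i) = fun r => z i := by
        funext r; simp [Finset.restrict, hi]
      rw [this]; exact differentiableAt_const _
  refine hd.congr_of_eventuallyEq ?_
  filter_upwards [hmem] with r' hr'
  simp only [sliceAt, hr', dif_pos]
  exact (hF ⟨_, hr'⟩).2

open Classical in
theorem sliceAt_of_mem {t : T} {f : V → ℝ} {z : T → ℝ} {r : ℝ}
    (h : Function.update z t r ∈ V) : sliceAt t f z r = f ⟨_, h⟩ := by
  simp [sliceAt, h]

theorem hasDerivAt_sliceAt_self (t : T) (f : smoothFunctions V) (z : V) :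
    HasDerivAt (sliceAt t f.1 z.1) (partialAt t f.1 z) (z.1 t) := by
  classical
  have h : Function.update z.1 t (z.1 t) ∈ V := by rw [Function.update_eq_self]; exact z.2
  have e : (⟨_, h⟩ : V) = z := Subtype.ext (Function.update_eq_self _ _)
  have := hasDerivAt_sliceAt t f z.1 (z.1 t) h
  rwa [e] at this

/-- The partial derivative `∂/∂y_t` as a derivation of `𝓕(V)`. -/
noncomputable def partialDerivation (V : TopologicalSpace.Opens (T → ℝ)) (t : T) :
    Derivation ℝ (smoothFunctions V) (smoothFunctions V) :=
  Derivation.mk' (R := ℝ)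
    { toFun := partialDeriv t
      map_add' := by
        classical
        intro f g
        refine Subtype.ext (funext fun z => ?_)
        have e : sliceAt t (f + g).1 z.1 = sliceAt t f.1 z.1 + sliceAt t g.1 z.1 := by
          funext r
          by_cases hr : Function.update z.1 t r ∈ V <;> simp [sliceAt, hr]
        have h := hasDerivAt_sliceAt_self t (f + g) z
        rw [e] at h
        exact h.unique ((hasDerivAt_sliceAt_self t f z).add (hasDerivAt_sliceAt_self t g z))
      map_smul' := by
        classical
        intro c f
        refine Subtype.ext (funext fun z => ?_)
        have e : sliceAt t (c • f).1 z.1 = fun r => c * sliceAt t f.1 z.1 r := by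
          funext r
          by_cases hr : Function.update z.1 t r ∈ V <;> simp [sliceAt, hr]
        have h := hasDerivAt_sliceAt_self t (c • f) z
        rw [e] at h
        exact h.unique ((hasDerivAt_sliceAt_self t f z).const_mul c) }
    (by
      classical
      intro f g
      refine Subtype.ext (funext fun z => ?_)
      have e : sliceAt t (f * g).1 z.1 = sliceAt t f.1 z.1 * sliceAt t g.1 z.1 := by
        funext r
        by_cases hr : Function.update z.1 t r ∈ V <;> simp [sliceAt, hr]
      have h := hasDerivAt_sliceAt_self t (f * g) z
      rw [e] at h
      have hz : Function.update z.1 t (z.1 t) ∈ V := by rw [Function.update_eq_self]; exact z.2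
      have ez : (⟨_, hz⟩ : V) = z := Subtype.ext (Function.update_eq_self _ _)
      have h' := (hasDerivAt_sliceAt_self t f z).mul (hasDerivAt_sliceAt_self t g z)
      rw [sliceAt_of_mem hz, sliceAt_of_mem hz, ez] at h'
      refine (h.unique h').trans ?_
      change _ = f.1 z * partialAt t g.1 z + g.1 z * partialAt t f.1 z
      ring)

theorem partialDeriv_zero (t : T) : partialDeriv t (0 : smoothFunctions V) = 0 :=
  (partialDerivation V t).map_zero

theorem partialDeriv_one (t : T) : partialDeriv t (1 : smoothFunctions V) = 0 :=
  (partialDerivation V t).map_one_eq_zero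

theorem partialDeriv_add (t : T) (f g : smoothFunctions V) :
    partialDeriv t (f + g) = partialDeriv t f + partialDeriv t g :=
  (partialDerivation V t).map_add f g

theorem partialDeriv_sub (t : T) (f g : smoothFunctions V) :
    partialDeriv t (f - g) = partialDeriv t f - partialDeriv t g :=
  (partialDerivation V t).map_sub f g

theorem partialDeriv_smul (t : T) (c : ℝ) (f : smoothFunctions V) :
    partialDeriv t (c • f) = c • partialDeriv t f :=
  (partialDerivation V t).map_smul c f

theorem partialDeriv_mul (t : T) (f g : smoothFunctions V) :
    partialDeriv t (f * g) = f * partialDeriv t g + g * partialDeriv t f :=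
  (partialDerivation V t).leibniz f g

open Classical in
theorem partialDeriv_coordFun (t t' : T) :
    partialDeriv t (coordFun V t') = if t' = t then 1 else 0 := by
  refine Subtype.ext (funext fun z => ?_)
  refine (partialAt_eq t _ {t'} (fun w => w ⟨t', Finset.mem_singleton_self t'⟩)
    (fun _ => ⟨(contDiff_apply ℝ ℝ _).contDiffAt, rfl⟩) z).trans ?_
  rw [(hasFDerivAt_apply _ _).fderiv]
  by_cases h : t' = t <;> simp [h]

theorem partialDeriv_coordFun_self (t : T) : partialDeriv t (coordFun V t) = 1 := by
  rw [partialDeriv_coordFun, if_pos rfl]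

theorem partialDeriv_coordFun_of_ne {t t' : T} (h : t' ≠ t) :
    partialDeriv t (coordFun V t') = 0 := by
  rw [partialDeriv_coordFun, if_neg h]

theorem partialDeriv_comm (t t' : T) (f : smoothFunctions V) :
    partialDeriv t (partialDeriv t' f) = partialDeriv t' (partialDeriv t f) := by
  classical
  obtain ⟨s, F, hF⟩ := f.2
  have hD : ∀ r : T, ∀ z : V,
      ContDiffAt ℝ ∞ (fun w => fderiv ℝ F w (fun i : s => if i.1 = r then 1 else 0))
        (s.restrict z.1) ∧ (partialDeriv r f).1 z =
        (fun w => fderiv ℝ F w (fun i : s => if i.1 = r then 1 else 0)) (s.restrict z.1) :=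
    fun r z => ⟨((hF z).1.fderiv_right (m := ∞) (by simp)).clm_apply contDiffAt_const,
      partialAt_eq r f.1 s F hF z⟩
  have h2 : ∀ r r' : T, ∀ z : V, (partialDeriv r' (partialDeriv r f)).1 z =
      fderiv ℝ (fderiv ℝ F) (s.restrict z.1) (fun i : s => if i.1 = r' then 1 else 0)
        (fun i : s => if i.1 = r then 1 else 0) := by
    intro r r' z
    refine (partialAt_eq r' _ s _ (hD r) z).trans ?_
    have hd : DifferentiableAt ℝ (fderiv ℝ F) (s.restrict z.1) :=
      ((hF z).1.fderiv_right (m := ∞) (by simp)).differentiableAt (by simp)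
    rw [fderiv_clm_apply hd (differentiableAt_const _)]
    simp
  refine Subtype.ext (funext fun z => ?_)
  rw [h2, h2]
  exact (hF z).1.isSymmSndFDerivAt
    (by simp only [minSmoothness_of_isRCLikeNormedField]; exact WithTop.coe_le_coe.2 le_top) _ _

theorem not_dependsOnVar {f : smoothFunctions V} {t : T} :
    ¬ DependsOnVar f t ↔ partialDeriv t f = 0 := not_not

/-- The subalgebra of the elements of `𝓕(V)` that depend on none of the variables in `P`. -/
noncomputable def indepOf (V : TopologicalSpace.Opens (T → ℝ)) (P : Set T) :
    Subalgebra ℝ (smoothFunctions V) where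
  carrier := {f | ∀ t ∈ P, partialDeriv t f = 0}
  mul_mem' := by
    intro f g hf hg t ht
    rw [partialDeriv_mul, hf t ht, hg t ht, mul_zero, mul_zero, add_zero]
  add_mem' := by
    intro f g hf hg t ht
    rw [partialDeriv_add, hf t ht, hg t ht, add_zero]
  algebraMap_mem' := by
    intro c t _
    exact (partialDerivation V t).map_algebraMap c

theorem indepOf_anti {P Q : Set T} (h : P ⊆ Q) : indepOf V Q ≤ indepOf V P :=
  fun _ hf t ht => hf t (h ht)

theorem partialDeriv_mem_indepOf {P : Set T} {f : smoothFunctions V} (hf : f ∈ indepOf V P)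
    (t : T) : partialDeriv t f ∈ indepOf V P := by
  intro t' ht'
  rw [partialDeriv_comm, hf t' ht', partialDeriv_zero]

theorem coordFun_mem_indepOf {P : Set T} {t : T} (ht : t ∉ P) : coordFun V t ∈ indepOf V P :=
  fun _ ht' => partialDeriv_coordFun_of_ne fun h => ht (h ▸ ht')

open Classical in
/-- Moving along a line segment in `V` in a direction on which `f` does not depend leaves the
value of `f` unchanged. -/
theorem apply_update_eq_of_segment {t : T} {f : smoothFunctions V}
    (hf : partialDeriv t f = 0)
    {z : V} {r : ℝ} (hr : ∀ r' ∈ Set.uIcc (z.1 t) r, Function.update z.1 t r' ∈ V) :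
    f.1 ⟨Function.update z.1 t r, hr r Set.right_mem_uIcc⟩ = f.1 z := by
  have hd : ∀ r' ∈ Set.uIcc (z.1 t) r, HasDerivAt (sliceAt t f.1 z.1) 0 r' := by
    intro r' h'
    have h := hasDerivAt_sliceAt t f z.1 r' (hr r' h')
    have h0 : partialAt t f.1 ⟨_, hr r' h'⟩ = 0 := congrFun (congrArg Subtype.val hf) _
    rwa [h0] at h
  have hc : sliceAt t f.1 z.1 (z.1 t) = sliceAt t f.1 z.1 r := by
    have h := (convex_uIcc (z.1 t) r).norm_image_sub_le_of_norm_hasDerivWithin_le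
      (C := 0) (fun r' h' => (hd r' h').hasDerivWithinAt) (fun _ _ => by simp)
      Set.left_mem_uIcc Set.right_mem_uIcc
    rw [zero_mul, norm_le_zero_iff, sub_eq_zero] at h
    exact h.symm
  rw [sliceAt_of_mem (hr _ Set.left_mem_uIcc), sliceAt_of_mem (hr _ Set.right_mem_uIcc)] at hc
  exact hc.symm.trans (congrArg f.1 (Subtype.ext (Function.update_eq_self _ _)))

end SmoothFunctions

/-! ### Total derivatives -/

section TotalDerivatives

variable {n m : ℕ} {V : TopologicalSpace.Opens (JetSpace n m)}

theorem shiftVar_zero (u : JetVar n m) : shiftVar 0 u = u := by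
  simp [shiftVar]

theorem shiftVar_add (δ ε : Fin n → ℕ) (u : JetVar n m) :
    shiftVar (δ + ε) u = shiftVar ε (shiftVar δ u) := by
  simp [shiftVar, add_assoc]

/-- Every multi-index is obtained from `0` by successively adding unit vectors. -/
theorem multiIndex_induction {p : (Fin n → ℕ) → Prop} (h0 : p 0)
    (hs : ∀ δ i, p δ → p (δ + Pi.single i 1)) (δ : Fin n → ℕ) : p δ := by
  induction h : ∑ i, δ i generalizing δ with
  | zero =>
    have : δ = 0 := funext fun i => (Finset.sum_eq_zero_iff.1 h) i (Finset.mem_univ i)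
    exact this ▸ h0
  | succ k ih =>
    obtain ⟨i, -, hi⟩ : ∃ i ∈ Finset.univ, δ i ≠ 0 :=
      Finset.exists_ne_zero_of_sum_ne_zero (by rw [h]; exact Nat.succ_ne_zero k)
    have e : δ = (δ - Pi.single i 1) + Pi.single i 1 := by
      funext j
      by_cases hj : j = i
      · subst hj; simp; omega
      · simp [hj]
    have hsum : ∑ j, (δ - Pi.single i 1 : Fin n → ℕ) j = k := by
      have h2 := congrArg (fun f : Fin n → ℕ => ∑ j, f j) e
      simp only [Pi.add_apply, Finset.sum_add_distrib, Finset.sum_pi_single',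
        Finset.mem_univ, if_true] at h2
      omega
    rw [e]
    exact hs _ _ (ih _ hsum)

theorem totalDeriv_eq_sum (i : Fin n) {f : smoothFunctions V} {s : Finset (JetIndex n m)}
    (hs : ∀ t ∉ s, partialDeriv t f = 0) :
    totalDeriv i f = ∑ t ∈ s, partialDeriv t f * totalDerivCoord V i t := by
  refine finsum_eq_sum_of_support_subset _ fun t ht => ?_
  by_contra hts
  exact ht (by simp only [hs t hts, zero_mul])

theorem exists_finset_partialDeriv_eq_zero {T : Type*} {V : TopologicalSpace.Opens (T → ℝ)}
    (f : smoothFunctions V) : ∃ s : Finset T, ∀ t ∉ s, partialDeriv t f = 0 :=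
  ⟨(finite_dependsOnVar f).toFinset, fun _ ht => not_not.1 fun h =>
    ht ((finite_dependsOnVar f).mem_toFinset.2 h)⟩

/-- The total derivative `D_i` as a linear map. -/
noncomputable def totalDerivLinear (V : TopologicalSpace.Opens (JetSpace n m)) (i : Fin n) :
    smoothFunctions V →ₗ[ℝ] smoothFunctions V where
  toFun := totalDeriv i
  map_add' := by
    classical
    intro f g
    obtain ⟨s, hs⟩ := exists_finset_partialDeriv_eq_zero f
    obtain ⟨s', hs'⟩ := exists_finset_partialDeriv_eq_zero g
    have h₁ : ∀ t ∉ s ∪ s', partialDeriv t f = 0 := fun t ht => hs t fun h => ht (by simp [h])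
    have h₂ : ∀ t ∉ s ∪ s', partialDeriv t g = 0 := fun t ht => hs' t fun h => ht (by simp [h])
    rw [totalDeriv_eq_sum i h₁, totalDeriv_eq_sum i h₂,
      totalDeriv_eq_sum i (s := s ∪ s') fun t ht => by
        rw [partialDeriv_add, h₁ t ht, h₂ t ht, add_zero], ← Finset.sum_add_distrib]
    exact Finset.sum_congr rfl fun t _ => by rw [partialDeriv_add, add_mul]
  map_smul' := by
    intro c f
    obtain ⟨s, hs⟩ := exists_finset_partialDeriv_eq_zero f
    rw [totalDeriv_eq_sum i hs, totalDeriv_eq_sum i (s := s) fun t ht => by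
        rw [partialDeriv_smul, hs t ht, smul_zero], RingHom.id_apply, Finset.smul_sum]
    exact Finset.sum_congr rfl fun t _ => by rw [partialDeriv_smul, smul_mul_assoc]

theorem totalDeriv_mul (i : Fin n) (f g : smoothFunctions V) :
    totalDeriv i (f * g) = f * totalDeriv i g + g * totalDeriv i f := by
  classical
  obtain ⟨s, hs⟩ := exists_finset_partialDeriv_eq_zero f
  obtain ⟨s', hs'⟩ := exists_finset_partialDeriv_eq_zero g
  have h₁ : ∀ t ∉ s ∪ s', partialDeriv t f = 0 := fun t ht => hs t fun h => ht (by simp [h])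
  have h₂ : ∀ t ∉ s ∪ s', partialDeriv t g = 0 := fun t ht => hs' t fun h => ht (by simp [h])
  rw [totalDeriv_eq_sum i h₁, totalDeriv_eq_sum i h₂,
    totalDeriv_eq_sum i (s := s ∪ s') fun t ht => by
      rw [partialDeriv_mul, h₁ t ht, h₂ t ht, mul_zero, mul_zero, add_zero],
    Finset.mul_sum, Finset.mul_sum, ← Finset.sum_add_distrib]
  refine Finset.sum_congr rfl fun t _ => ?_
  rw [partialDeriv_mul]
  ring

theorem totalDeriv_zero (i : Fin n) : totalDeriv i (0 : smoothFunctions V) = 0 :=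
  (totalDerivLinear V i).map_zero

theorem totalDeriv_one (i : Fin n) : totalDeriv i (1 : smoothFunctions V) = 0 := by
  rw [totalDeriv_eq_sum i (s := ∅) fun t _ => partialDeriv_one t, Finset.sum_empty]

theorem totalDeriv_add (i : Fin n) (f g : smoothFunctions V) :
    totalDeriv i (f + g) = totalDeriv i f + totalDeriv i g :=
  (totalDerivLinear V i).map_add f g

theorem totalDeriv_sub (i : Fin n) (f g : smoothFunctions V) :
    totalDeriv i (f - g) = totalDeriv i f - totalDeriv i g :=
  (totalDerivLinear V i).map_sub f g

theorem totalDeriv_sum (i : Fin n) {ι : Type*} (s : Finset ι) (f : ι → smoothFunctions V) :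
    totalDeriv i (∑ j ∈ s, f j) = ∑ j ∈ s, totalDeriv i (f j) :=
  map_sum (totalDerivLinear V i) f s

theorem totalDeriv_coordFun (i : Fin n) (t : JetIndex n m) :
    totalDeriv i (coordFun V t) = totalDerivCoord V i t := by
  classical
  rw [totalDeriv_eq_sum i (s := {t}) fun t' ht' =>
    partialDeriv_coordFun_of_ne fun h => ht' (by simp [h]), Finset.sum_singleton,
    partialDeriv_coordFun_self, one_mul]

theorem totalDeriv_totalDerivCoord_comm (i j : Fin n) (t : JetIndex n m) :
    totalDeriv i (totalDerivCoord V j t) = totalDeriv j (totalDerivCoord V i t) := by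
  rcases t with k | u
  · have h : ∀ i j : Fin n, totalDeriv i (totalDerivCoord V j (Sum.inl k)) = 0 := by
      intro i j
      simp only [totalDerivCoord]
      split_ifs
      · exact totalDeriv_one i
      · exact totalDeriv_zero i
    rw [h, h]
  · simp only [totalDerivCoord, totalDeriv_coordFun, ← shiftVar_add]
    rw [add_comm]

/-- The commutator of `D_i` and `D_j` has no second order part by the symmetry of second derivatives,
and no first order part because `D_i` and `D_j` commute on the coordinate functions. -/
theorem totalDeriv_comm (i j : Fin n) (f : smoothFunctions V) :
    totalDeriv i (totalDeriv j f) = totalDeriv j (totalDeriv i f) := by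
  obtain ⟨s, hs⟩ := exists_finset_partialDeriv_eq_zero f
  have h : ∀ i j : Fin n, totalDeriv i (totalDeriv j f) =
      ∑ t ∈ s, (∑ r ∈ s, partialDeriv r (partialDeriv t f) * totalDerivCoord V i r *
        totalDerivCoord V j t + partialDeriv t f * totalDeriv i (totalDerivCoord V j t)) := by
    intro i j
    rw [totalDeriv_eq_sum j hs, totalDeriv_sum]
    refine Finset.sum_congr rfl fun t _ => ?_
    rw [totalDeriv_mul, totalDeriv_eq_sum i (f := partialDeriv t f) (s := s) fun r hr => by
      rw [partialDeriv_comm, hs r hr, partialDeriv_zero], add_comm, Finset.mul_sum]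
    congr 1
    exact Finset.sum_congr rfl fun r _ => by ring
  rw [h, h, Finset.sum_add_distrib, Finset.sum_add_distrib, Finset.sum_comm]
  congr 1
  · refine Finset.sum_congr rfl fun t _ => Finset.sum_congr rfl fun r _ => ?_
    rw [partialDeriv_comm]
    ring
  · exact Finset.sum_congr rfl fun t _ => by rw [totalDeriv_totalDerivCoord_comm]

theorem totalDerivMulti_zero (f : smoothFunctions V) : totalDerivMulti 0 f = f := by
  unfold totalDerivMulti
  induction List.finRange n with
  | nil => rfl
  | cons i l ih => exact ih

theorem totalDerivMulti_add_single (δ : Fin n → ℕ) (i : Fin n) (f : smoothFunctions V) :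
    totalDerivMulti (δ + Pi.single i 1) f = totalDeriv i (totalDerivMulti δ f) := by
  have key : ∀ l : List (Fin n), l.Nodup →
      l.foldr (fun j g => (totalDeriv j)^[(δ + Pi.single i 1 : Fin n → ℕ) j] g) f =
      if i ∈ l then totalDeriv i (l.foldr (fun j g => (totalDeriv j)^[δ j] g) f)
      else l.foldr (fun j g => (totalDeriv j)^[δ j] g) f := by
    intro l hl
    induction l with
    | nil => simp
    | cons j l ih =>
      obtain ⟨hj, hl⟩ := List.nodup_cons.1 hl
      rw [List.foldr_cons, List.foldr_cons, ih hl]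
      by_cases hij : i = j
      · subst hij
        rw [if_neg hj, if_pos List.mem_cons_self]
        simp [Function.iterate_succ_apply']
      · have h1 : (δ + Pi.single i 1 : Fin n → ℕ) j = δ j := by simp [Ne.symm hij]
        rw [h1]
        by_cases hil : i ∈ l
        · rw [if_pos hil, if_pos (List.mem_cons_of_mem _ hil)]
          have hc : Function.Commute (totalDeriv (V := V) j) (totalDeriv i) :=
            fun g => totalDeriv_comm j i g
          exact (hc.iterate_left (δ j)) _
        · rw [if_neg hil, if_neg (by simp [hij, hil])]
  have := key _ (List.nodup_finRange n)
  rwa [if_pos (List.mem_finRange i)] at this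

theorem totalDerivMulti_add (δ ε : Fin n → ℕ) (f : smoothFunctions V) :
    totalDerivMulti (δ + ε) f = totalDerivMulti ε (totalDerivMulti δ f) := by
  induction ε using multiIndex_induction with
  | h0 => rw [add_zero, totalDerivMulti_zero]
  | hs ε i ih => rw [← add_assoc, totalDerivMulti_add_single, totalDerivMulti_add_single, ih]

theorem totalDerivMulti_sub (δ : Fin n → ℕ) (f g : smoothFunctions V) :
    totalDerivMulti δ (f - g) = totalDerivMulti δ f - totalDerivMulti δ g := by
  induction δ using multiIndex_induction with
  | h0 => simp only [totalDerivMulti_zero]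
  | hs δ i ih =>
    simp only [totalDerivMulti_add_single, ih, totalDeriv_sub]

end TotalDerivatives

/-! ### Leading terms and the ideals of lower equations -/

section Reduction

variable {n m : ℕ} {Γ : Type*} [LinearOrder Γ] {V : TopologicalSpace.Opens (JetSpace n m)}
  {lvl : JetVar n m → Γ} {S : Set (smoothFunctions V)} {lt : smoothFunctions V → JetVar n m}

/-- The variables lying in the block of level `γ` or in a higher one. -/
def upperVars (lvl : JetVar n m → Γ) (γ : Γ) : Set (JetIndex n m) :=
  Sum.inr '' {v | γ ≤ lvl v}

theorem precVar_iff_mem_indepOf {g : smoothFunctions V} {u : JetVar n m} :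
    PrecVar lvl g u ↔ g ∈ indepOf V (upperVars lvl (lvl u)) := by
  constructor
  · rintro h _ ⟨v, hv, rfl⟩
    by_contra hd
    exact absurd (h v hd) (not_lt.2 hv)
  · intro h v hv
    by_contra hlt
    exact hv (h _ ⟨v, not_lt.1 hlt, rfl⟩)

theorem IsStratification.lvl_le_shiftVar (hlvl : IsStratification lvl) (δ : Fin n → ℕ)
    (u : JetVar n m) : lvl u ≤ lvl (shiftVar δ u) := by
  by_cases h : δ = 0
  · rw [h, shiftVar_zero]
  · exact (hlvl.lt_shift δ u h).le

theorem upperVars_anti {γ γ' : Γ} (h : γ ≤ γ') : upperVars lvl γ' ⊆ upperVars lvl γ := by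
  rintro _ ⟨v, hv, rfl⟩
  exact ⟨v, h.trans hv, rfl⟩

theorem totalDeriv_mem_indepOf_upperVars (hlvl : IsStratification lvl) (i : Fin n)
    {g : smoothFunctions V} {u : JetVar n m} (hg : g ∈ indepOf V (upperVars lvl (lvl u))) :
    totalDeriv i g ∈ indepOf V (upperVars lvl (lvl (shiftVar (Pi.single i 1) u))) := by
  obtain ⟨s, hs⟩ := exists_finset_partialDeriv_eq_zero g
  rw [totalDeriv_eq_sum i hs]
  refine sum_mem fun t _ => ?_
  by_cases h0 : partialDeriv t g = 0
  · rw [h0, zero_mul]; exact zero_mem _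
  refine mul_mem (indepOf_anti (upperVars_anti (hlvl.lvl_le_shiftVar _ _))
    (partialDeriv_mem_indepOf hg t)) ?_
  rcases t with k | a
  · simp only [totalDerivCoord]
    split_ifs
    · exact one_mem _
    · exact zero_mem _
  · refine coordFun_mem_indepOf ?_
    rintro ⟨v, hv, hva⟩
    obtain rfl := Sum.inr_injective hva
    have ha : lvl a < lvl u := not_le.1 fun h => h0 (hg _ ⟨a, h, rfl⟩)
    exact absurd (hlvl.strictMono (Pi.single i 1) _ _ ha) (not_lt.2 hv)

/-- `D^δ (u + g) = δ u + g'` with `g' ≺ δ u` if `g ≺ u`. -/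
theorem totalDerivMulti_sub_coordFun_mem (hlvl : IsStratification lvl) {f : smoothFunctions V}
    {u : JetVar n m} (hf : f - coordFun V (Sum.inr u) ∈ indepOf V (upperVars lvl (lvl u)))
    (δ : Fin n → ℕ) :
    totalDerivMulti δ f - coordFun V (Sum.inr (shiftVar δ u)) ∈
      indepOf V (upperVars lvl (lvl (shiftVar δ u))) := by
  induction δ using multiIndex_induction with
  | h0 => rwa [totalDerivMulti_zero, shiftVar_zero]
  | hs δ i ih =>
    rw [totalDerivMulti_add_single, shiftVar_add]
    have h := totalDeriv_mem_indepOf_upperVars hlvl i ih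
    rwa [totalDeriv_sub, totalDeriv_coordFun] at h

/-- The ideal generated by the elements of the orbit of `S` with leading terms below level `γ`. -/
noncomputable def lowerIdeal (lvl : JetVar n m → Γ) (S : Set (smoothFunctions V))
    (lt : smoothFunctions V → JetVar n m) (γ : Γ) : Ideal (smoothFunctions V) :=
  Ideal.span {h | ∃ f ∈ S, ∃ δ, lvl (shiftVar δ (lt f)) < γ ∧ h = totalDerivMulti δ f}

theorem lowerIdeal_mono {γ γ' : Γ} (h : γ ≤ γ') :
    lowerIdeal lvl S lt γ ≤ lowerIdeal lvl S lt γ' :=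
  Ideal.span_mono fun _ ⟨f, hf, δ, hδ, e⟩ => ⟨f, hf, δ, hδ.trans_le h, e⟩

theorem totalDeriv_mem_lowerIdeal (hlvl : IsStratification lvl) (i : Fin n) {u : JetVar n m}
    {h : smoothFunctions V} (hh : h ∈ lowerIdeal lvl S lt (lvl u)) :
    totalDeriv i h ∈ lowerIdeal lvl S lt (lvl (shiftVar (Pi.single i 1) u)) := by
  have hle := lowerIdeal_mono (lvl := lvl) (S := S) (lt := lt) (hlvl.lvl_le_shiftVar (Pi.single i 1) u)
  refine Submodule.span_induction (p := fun h _ => totalDeriv i h ∈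
    lowerIdeal lvl S lt (lvl (shiftVar (Pi.single i 1) u))) ?_ ?_ ?_ ?_ hh
  · rintro _ ⟨f, hf, δ, hδ, rfl⟩
    refine Ideal.subset_span ⟨f, hf, δ + Pi.single i 1, ?_, (totalDerivMulti_add_single _ _ _).symm⟩
    rw [shiftVar_add]
    exact hlvl.strictMono _ _ _ hδ
  · rw [totalDeriv_zero]
    exact zero_mem _
  · intro x y _ _ hx hy
    rw [totalDeriv_add]
    exact add_mem hx hy
  · intro a x hx hDx
    rw [smul_eq_mul, totalDeriv_mul]
    exact add_mem (Ideal.mul_mem_left _ _ hDx) (Ideal.mul_mem_right _ _ (hle hx))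

/-- The lower ideals are compatible with the action of `ℕ^n` on the levels. -/
theorem totalDerivMulti_mem_lowerIdeal (hlvl : IsStratification lvl) (δ : Fin n → ℕ)
    {u : JetVar n m} {h : smoothFunctions V} (hh : h ∈ lowerIdeal lvl S lt (lvl u)) :
    totalDerivMulti δ h ∈ lowerIdeal lvl S lt (lvl (shiftVar δ u)) := by
  induction δ using multiIndex_induction with
  | h0 => rwa [totalDerivMulti_zero, shiftVar_zero]
  | hs δ i ih =>
    rw [totalDerivMulti_add_single, shiftVar_add]
    exact totalDeriv_mem_lowerIdeal hlvl i ih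

/-- A reduction step subtracts a multiple of `D^δ f`. When this multiple is not zero, the leading
term of `D^δ f` is not above the variables of `F`: otherwise `F`, `q` and `r` would not depend on
this leading term, and differentiating `F = q D^δ f + r` along it would give `q = 0`. -/
theorem ReducesByFunction.mem_lowerIdeal (hlvl : IsStratification lvl)
    (hlt : ∀ f ∈ S, IsOrderlySolvable lvl f (lt f)) {γ : Γ} {f F r : smoothFunctions V}
    (hf : f ∈ S) (h : ReducesByFunction lvl f (lt f) F r)
    (hF : F ∈ indepOf V (upperVars lvl γ)) :
    r ∈ indepOf V (upperVars lvl γ) ∧ F - r ∈ lowerIdeal lvl S lt γ := by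
  obtain ⟨δ, q, -, hFq, hr, hqF, hrF⟩ := h
  refine ⟨?_, ?_⟩
  · rintro _ ⟨v, hv, rfl⟩
    by_contra hd
    obtain ⟨w, hw, hvw⟩ := hrF v hd
    exact hw (hF _ ⟨w, le_trans hv hvw, rfl⟩)
  · have hFr : F - r = q * totalDerivMulti δ f := by rw [hFq]; ring
    rw [hFr]
    by_cases hex : ∃ w, DependsOnVar F (Sum.inr w) ∧ lvl (shiftVar δ (lt f)) ≤ lvl w
    · obtain ⟨w, hw, hle⟩ := hex
      refine Ideal.mul_mem_left _ _ (Ideal.subset_span ⟨f, hf, δ, hle.trans_lt ?_, rfl⟩)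
      exact not_le.1 fun h => hw (hF _ ⟨w, h, rfl⟩)
    · have hF0 : partialDeriv (Sum.inr (shiftVar δ (lt f))) F = 0 :=
        not_not.1 fun h => hex ⟨_, h, le_rfl⟩
      have hq0 : partialDeriv (Sum.inr (shiftVar δ (lt f))) q = 0 :=
        not_not.1 fun h => hex (hqF _ h)
      have hr0 := not_dependsOnVar.1 hr
      have hD : partialDeriv (Sum.inr (shiftVar δ (lt f))) (totalDerivMulti δ f) = 1 := by
        have h1 := totalDerivMulti_sub_coordFun_mem hlvl
          (precVar_iff_mem_indepOf.1 (hlt f hf)) δ _ ⟨shiftVar δ (lt f), le_refl _, rfl⟩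
        rw [partialDeriv_sub, partialDeriv_coordFun_self, sub_eq_zero] at h1
        exact h1
      have h2 := congrArg (partialDeriv (Sum.inr (shiftVar δ (lt f)))) hFq
      rw [partialDeriv_add, partialDeriv_mul, hF0, hq0, hr0, hD, mul_zero, add_zero, add_zero,
        mul_one] at h2
      rw [← h2, zero_mul]
      exact zero_mem _

theorem Reduces.mem_lowerIdeal (hlvl : IsStratification lvl)
    (hlt : ∀ f ∈ S, IsOrderlySolvable lvl f (lt f)) {γ : Γ} {F r : smoothFunctions V}
    (h : Reduces lvl S lt F r) (hF : F ∈ indepOf V (upperVars lvl γ)) :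
    F - r ∈ lowerIdeal lvl S lt γ := by
  refine (?_ : r ∈ indepOf V (upperVars lvl γ) ∧ F - r ∈ lowerIdeal lvl S lt γ).2
  obtain ⟨-, h⟩ := h
  induction h with
  | refl => exact ⟨hF, by rw [sub_self]; exact zero_mem _⟩
  | tail _ hstep ih =>
    obtain ⟨f, hf, hstep⟩ := hstep
    obtain ⟨h1, h2⟩ := hstep.mem_lowerIdeal hlvl hlt hf ih.1
    refine ⟨h1, ?_⟩
    have := add_mem ih.2 h2
    rwa [sub_add_sub_cancel] at this

/-- Under the reducibility conditions, two elements of the orbit of `S` with the same leading term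
`v` differ by an element of the ideal generated by the elements with leading terms below `v`. -/
theorem sub_mem_lowerIdeal_of_shiftVar_eq (hlvl : IsStratification lvl)
    (hlt : ∀ f ∈ S, IsOrderlySolvable lvl f (lt f)) (hred : SatisfiesReducibility lvl S lt)
    {f₁ f₂ : smoothFunctions V} (h₁ : f₁ ∈ S) (h₂ : f₂ ∈ S) {δ₁ δ₂ : Fin n → ℕ}
    (h : shiftVar δ₁ (lt f₁) = shiftVar δ₂ (lt f₂)) :
    totalDerivMulti δ₁ f₁ - totalDerivMulti δ₂ f₂ ∈
      lowerIdeal lvl S lt (lvl (shiftVar δ₁ (lt f₁))) := by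
  have hi : (lt f₁).1 = (lt f₂).1 := (Prod.ext_iff.1 h).1
  have hs : (lt f₁).2 + δ₁ = (lt f₂).2 + δ₂ := (Prod.ext_iff.1 h).2
  have hs' : ∀ i, (lt f₁).2 i + δ₁ i = (lt f₂).2 i + δ₂ i := fun i => congrFun hs i
  set α := (lt f₁).2
  set β := (lt f₂).2
  -- `δ₁ = a + ε` and `δ₂ = b + ε`, so that `D^{δ₁} f₁ - D^{δ₂} f₂ = D^ε τ(f₁, f₂)`
  set a : Fin n → ℕ := fun i => max (α i) (β i) - α i with ha
  set b : Fin n → ℕ := fun i => max (β i) (α i) - β i with hb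
  set ε : Fin n → ℕ := fun i => α i + δ₁ i - max (α i) (β i) with hε
  have e₁ : δ₁ = a + ε := by
    funext i
    have := hs' i
    simp only [ha, hε, Pi.add_apply]
    omega
  have e₂ : δ₂ = b + ε := by
    funext i
    have := hs' i
    simp only [hb, hε, Pi.add_apply]
    omega
  have hab : shiftVar a (lt f₁) = shiftVar b (lt f₂) := by
    refine Prod.ext hi (funext fun i => ?_)
    change α i + a i = β i + b i
    simp only [ha, hb]
    omega
  have hτ : tauDiff α β f₁ f₂ ∈ lowerIdeal lvl S lt (lvl (shiftVar a (lt f₁))) := by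
    have hmem := (hred f₁ h₁ f₂ h₂ hi).mem_lowerIdeal hlvl hlt
      (γ := lvl (shiftVar a (lt f₁))) ?_
    · rwa [sub_zero] at hmem
    · have g₁ := totalDerivMulti_sub_coordFun_mem hlvl (precVar_iff_mem_indepOf.1 (hlt f₁ h₁)) a
      have g₂ := totalDerivMulti_sub_coordFun_mem hlvl (precVar_iff_mem_indepOf.1 (hlt f₂ h₂)) b
      rw [← hab] at g₂
      have := sub_mem g₁ g₂
      rwa [sub_sub_sub_cancel_right] at this
  have := totalDerivMulti_mem_lowerIdeal hlvl ε hτ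
  rw [tauDiff, totalDerivMulti_sub, ← totalDerivMulti_add, ← totalDerivMulti_add,
    ← shiftVar_add] at this
  rw [e₁, e₂]
  exact this

/-- A choice, for every principal variable `v`, of one element of the orbit of `S` with leading
term `v`; these elements generate the ideal `⟨⟨S⟩⟩`. -/
theorem exists_triangular_generators [WellFoundedLT Γ] (hlvl : IsStratification lvl)
    (hlt : ∀ f ∈ S, IsOrderlySolvable lvl f (lt f)) (hred : SatisfiesReducibility lvl S lt) :
    ∃ F : JetVar n m → smoothFunctions V,
      (∀ v ∈ varOrbit (lt '' S), F v ∈ diffOrbit S ∧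
        F v - coordFun V (Sum.inr v) ∈ indepOf V (upperVars lvl (lvl v))) ∧
      Ideal.span (diffOrbit S) = Ideal.span (F '' varOrbit (lt '' S)) := by
  have hch : ∀ v : JetVar n m, ∃ F : smoothFunctions V, v ∈ varOrbit (lt '' S) →
      ∃ f ∈ S, ∃ δ, v = shiftVar δ (lt f) ∧ F = totalDerivMulti δ f := by
    intro v
    by_cases hv : v ∈ varOrbit (lt '' S)
    · obtain ⟨_, ⟨f, hf, rfl⟩, δ, rfl⟩ := hv
      exact ⟨_, fun _ => ⟨f, hf, δ, rfl, rfl⟩⟩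
    · exact ⟨0, fun h => absurd h hv⟩
  choose F hF using hch
  refine ⟨F, fun v hv => ?_, le_antisymm (Ideal.span_le.2 ?_) (Ideal.span_mono ?_)⟩
  · obtain ⟨f, hf, δ, e, hFv⟩ := hF v hv
    refine ⟨⟨f, hf, δ, hFv⟩, ?_⟩
    rw [hFv, e]
    exact totalDerivMulti_sub_coordFun_mem hlvl (precVar_iff_mem_indepOf.1 (hlt f hf)) δ
  · have key : ∀ γ : Γ, ∀ f ∈ S, ∀ δ, lvl (shiftVar δ (lt f)) = γ →
        totalDerivMulti δ f ∈ Ideal.span (F '' varOrbit (lt '' S)) := by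
      intro γ
      induction γ using WellFoundedLT.induction with
      | ind γ ih =>
        rintro f hf δ rfl
        have hv : shiftVar δ (lt f) ∈ varOrbit (lt '' S) := ⟨_, ⟨f, hf, rfl⟩, δ, rfl⟩
        obtain ⟨f', hf', δ', e, hFv⟩ := hF _ hv
        have h1 := sub_mem_lowerIdeal_of_shiftVar_eq hlvl hlt hred hf hf' e
        rw [← hFv] at h1
        have h2 : lowerIdeal lvl S lt (lvl (shiftVar δ (lt f))) ≤
            Ideal.span (F '' varOrbit (lt '' S)) := by
          refine Ideal.span_le.2 ?_
          rintro _ ⟨g, hg, ε, hlt', rfl⟩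
          exact ih _ hlt' g hg ε rfl
        have := add_mem (h2 h1) (Ideal.subset_span ⟨_, hv, rfl⟩)
        rwa [sub_add_cancel] at this
    rintro _ ⟨f, hf, δ, rfl⟩
    exact key _ f hf δ rfl
  · rintro _ ⟨v, hv, rfl⟩
    obtain ⟨f, hf, δ, -, hFv⟩ := hF v hv
    exact ⟨f, hf, δ, hFv⟩

end Reduction

/-! ### Triangular systems define smooth manifolds -/

section Triangular

variable {T : Type*} {V : TopologicalSpace.Opens (T → ℝ)}

theorem mem_smoothFunctions_of_eq {f g : V → ℝ} (hg : g ∈ smoothFunctions V)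
    (h : ∀ z, f z = g z) : f ∈ smoothFunctions V :=
  (funext h : f = g) ▸ hg

/-- On a box contained in `V` the absence of a variable in the sense of partial derivatives is
actual independence of it. Only finitely many of the variables have to be moved, one at a time. -/
theorem apply_eq_of_eqOn_compl {f : smoothFunctions V} {Q : Set T}
    (hf : f ∈ indepOf V Q) {B : T → Set ℝ} (hB : ∀ t, (B t).OrdConnected)
    (hBV : ∀ z : T → ℝ, (∀ t, z t ∈ B t) → z ∈ V) {z z' : V}
    (hz : ∀ t, z.1 t ∈ B t) (hz' : ∀ t, z'.1 t ∈ B t)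
    (hzz' : ∀ t, t ∉ Q → z.1 t = z'.1 t) : f.1 z = f.1 z' := by
  classical
  obtain ⟨s, F, hF⟩ := f.2
  have key : ∀ d : Finset T, ∀ z : V, (∀ t, z.1 t ∈ B t) →
      (∀ t, t ∉ Q → z.1 t = z'.1 t) → (∀ t ∈ s, t ∉ d → z.1 t = z'.1 t) → f.1 z = f.1 z' := by
    intro d
    induction d using Finset.induction_on with
    | empty =>
      intro z _ _ h
      rw [(hF z).2, (hF z').2]
      congr 1
      exact funext fun t => h t.1 t.2 (Finset.notMem_empty _)
    | insert t d _ ih =>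
      intro z hz hQ hd
      by_cases htQ : t ∈ Q
      · have hseg : ∀ r ∈ Set.uIcc (z.1 t) (z'.1 t), Function.update z.1 t r ∈ V := by
          intro r hr
          refine hBV _ fun t' => ?_
          by_cases ht : t' = t
          · subst ht
            rw [Function.update_self]
            exact (hB t').uIcc_subset (hz t') (hz' t') hr
          · rw [Function.update_of_ne ht]
            exact hz t'
        have h1 := apply_update_eq_of_segment (hf t htQ) (z := z) (r := z'.1 t)
          (fun r hr => by convert hseg r hr)
        rw [← h1]
        refine ih _ (fun t' => ?_) (fun t' ht' => ?_) (fun t' hs ht' => ?_)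
        · by_cases ht : t' = t
          · subst ht; simpa using hz' t'
          · simpa [ht] using hz t'
        · by_cases ht : t' = t
          · subst ht; simp
          · simpa [ht] using hQ t' ht'
        · by_cases ht : t' = t
          · subst ht; simp
          · simpa [ht] using hd t' hs (by simp [ht, ht'])
      · refine ih z hz hQ fun t' hs ht' => ?_
        by_cases ht : t' = t
        · subst ht; exact hQ t' htQ
        · exact hd t' hs (by simp [ht, ht'])
  exact key s z hz hzz' fun t hs hns => absurd hs hns

/-- Around every point of `V` there are an open neighbourhood `N` and continuous coordinatewise
retractions `κ` onto a closed box `B ⊆ V` that fix `N`. -/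
theorem exists_box (a : V) : ∃ (B : T → Set ℝ) (κ : T → ℝ → ℝ) (N : Set (T → ℝ)),
    (∀ t, (B t).OrdConnected) ∧ (∀ z : T → ℝ, (∀ t, z t ∈ B t) → z ∈ V) ∧
    (∀ t, a.1 t ∈ B t) ∧ (∀ t, Continuous (κ t)) ∧ (∀ t r, κ t r ∈ B t) ∧
    IsOpen N ∧ a.1 ∈ N ∧ (∀ z ∈ N, ∀ t, z t ∈ B t ∧ κ t (z t) = z t) := by
  classical
  obtain ⟨I, u, hu, hI⟩ := isOpen_pi_iff.1 V.isOpen a.1 a.2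
  have hε : ∀ t, ∃ ε > 0, t ∈ I → Metric.closedBall (a.1 t) ε ⊆ u t := by
    intro t
    by_cases ht : t ∈ I
    · obtain ⟨ε, h0, h⟩ := Metric.nhds_basis_closedBall.mem_iff.1
        ((hu t ht).1.mem_nhds (hu t ht).2)
      exact ⟨ε, h0, fun _ => h⟩
    · exact ⟨1, one_pos, fun h => absurd h ht⟩
  choose ε hε0 hε using hε
  refine ⟨fun t => if t ∈ I then Set.Icc (a.1 t - ε t) (a.1 t + ε t) else Set.univ,
    fun t r => if t ∈ I then max (a.1 t - ε t) (min (a.1 t + ε t) r) else r,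
    (I : Set T).pi fun t => Set.Ioo (a.1 t - ε t) (a.1 t + ε t), ?_, ?_, ?_, ?_, ?_, ?_, ?_, ?_⟩
  · intro t
    dsimp only
    split_ifs
    · exact Set.ordConnected_Icc
    · exact Set.ordConnected_univ
  · intro z hz
    refine hI fun t ht => hε t ht ?_
    have := hz t
    simp only [Finset.mem_coe.1 ht, if_true] at this
    rwa [Real.closedBall_eq_Icc]
  · intro t
    have := hε0 t
    dsimp only
    split_ifs
    · exact ⟨by linarith, by linarith⟩
    · trivial
  · intro t
    by_cases ht : t ∈ I
    · simp only [ht, if_true]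
      fun_prop
    · simp only [ht, if_false]
      fun_prop
  · intro t r
    have := hε0 t
    dsimp only
    split_ifs
    · exact ⟨le_max_left _ _, max_le (by linarith) (min_le_left _ _)⟩
    · trivial
  · exact isOpen_set_pi I.finite_toSet fun _ _ => isOpen_Ioo
  · intro t _
    have := hε0 t
    exact ⟨by linarith, by linarith⟩
  · intro z hz t
    dsimp only
    split_ifs with ht
    · obtain ⟨h1, h2⟩ := hz t ht
      exact ⟨⟨h1.le, h2.le⟩, by rw [min_eq_right h2.le, max_eq_right h1.le]⟩
    · exact ⟨trivial, rfl⟩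

/-- The common zero set of functions `F t = y_t + g_t`, `t ∈ P`, such that `g_t` depends only on
variables of lower rank than `y_t`, is a smooth manifold.

Near a point, `y_t ↦ F t` for `t ∈ P` and `y_t ↦ y_t` otherwise is a change of coordinates whose
inverse is found by recursion on the rank. For the recursion to be defined everywhere, the `g_t` are
composed with a retraction onto a box. -/
theorem isSmoothManifold_of_triangular {Γ : Type*} [LinearOrder Γ] [WellFoundedLT Γ] (rk : T → Γ)
    (P : Set T) (F : T → smoothFunctions V)
    (hF : ∀ t ∈ P, F t - coordFun V t ∈ indepOf V {t' | ¬ rk t' < rk t}) :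
    IsSmoothManifold {z | ∃ hz : z ∈ V, ∀ t ∈ P, (F t).1 ⟨z, hz⟩ = 0} := by
  classical
  rintro a ⟨haV, -⟩
  obtain ⟨B, κ, N, hB, hBV, haB, hκ, hκB, hNo, haN, hN⟩ := exists_box (⟨a, haV⟩ : V)
  have hNV : ∀ z ∈ N, z ∈ V := fun z hz => hBV z fun t => (hN z hz t).1
  set g : T → smoothFunctions V := fun t => F t - coordFun V t with hg
  -- the point at which `g t` is evaluated: coordinates of lower rank are retracted onto the box,
  -- the irrelevant ones are replaced by those of `a`
  have hρV : ∀ t (w : ∀ t', rk t' < rk t → ℝ),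
      (fun t' => if h : rk t' < rk t then κ t' (w t' h) else a t') ∈ V := by
    intro t w
    refine hBV _ fun t' => ?_
    split_ifs
    · exact hκB _ _
    · exact haB t'
  set gt : ∀ t, (∀ t', rk t' < rk t → ℝ) → ℝ := fun t w => (g t).1 ⟨_, hρV t w⟩ with hgt
  have hgt_cont : ∀ t (w : (T → ℝ) → ∀ t', rk t' < rk t → ℝ),
      (∀ t' h, Continuous fun z => w z t' h) → Continuous fun z => gt t (w z) := by
    intro t w hw
    refine (continuous_of_mem_smoothFunctions (g t).2).comp (Continuous.subtype_mk ?_ _)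
    refine continuous_pi fun t' => ?_
    by_cases h : rk t' < rk t
    · simp only [h, dif_pos]
      exact (hκ t').comp (hw t' h)
    · simp only [h, dif_neg, not_false_iff]
      exact continuous_const
  have hgt_N : ∀ t ∈ P, ∀ z (hz : z ∈ N), gt t (fun t' _ => z t') = (g t).1 ⟨z, hNV z hz⟩ := by
    intro t ht z hz
    refine apply_eq_of_eqOn_compl (hF t ht) hB hBV (fun t' => ?_) (fun t' => (hN z hz t').1) ?_
    · dsimp only
      split_ifs
      · exact hκB _ _
      · exact haB t'
    · intro t' ht'
      have ht' : rk t' < rk t := not_not.1 ht'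
      simp only [ht', dif_pos]
      exact (hN z hz t').2
  set Φ : (T → ℝ) → T → ℝ := fun z t => if t ∈ P then z t + gt t (fun t' _ => z t') else z t with hΦ
  have hwf : WellFounded fun t t' : T => rk t < rk t' := InvImage.wf rk wellFounded_lt
  set Ψ : (T → ℝ) → T → ℝ := fun y => hwf.fix fun t w => if t ∈ P then y t - gt t w else y t with hΨ
  have hΨ_eq : ∀ y t, Ψ y t = if t ∈ P then y t - gt t (fun t' _ => Ψ y t') else y t :=
    fun y t => hwf.fix_eq _ t
  have hΦΨ : ∀ y, Φ (Ψ y) = y := by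
    intro y
    funext t
    by_cases ht : t ∈ P
    · have h1 : Φ (Ψ y) t = Ψ y t + gt t (fun t' _ => Ψ y t') := if_pos ht
      rw [h1, hΨ_eq y t, if_pos ht, sub_add_cancel]
    · have h1 : Φ (Ψ y) t = Ψ y t := if_neg ht
      rw [h1, hΨ_eq y t, if_neg ht]
  have hΨΦ : ∀ z, Ψ (Φ z) = z := by
    intro z
    funext t
    induction t using hwf.induction with
    | h t ih =>
    rw [hΨ_eq]
    by_cases ht : t ∈ P
    · have h2 : (fun t' (_ : rk t' < rk t) => Ψ (Φ z) t') = fun t' _ => z t' :=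
        funext fun t' => funext fun h => ih t' h
      have h1 : Φ z t = z t + gt t (fun t' _ => z t') := if_pos ht
      rw [if_pos ht, h2, h1, add_sub_cancel_right]
    · rw [if_neg ht]
      exact if_neg ht
  have hΦc : Continuous Φ := by
    refine continuous_pi fun t => ?_
    by_cases ht : t ∈ P
    · simp only [hΦ, ht, if_true]
      exact (continuous_apply t).add (hgt_cont t _ fun t' _ => continuous_apply t')
    · simp only [hΦ, ht, if_false]
      exact continuous_apply t
  have hΨc : Continuous Ψ := by
    refine continuous_pi fun t => ?_
    induction t using hwf.induction with
    | h t ih =>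
    simp only [hΨ_eq _ t]
    by_cases ht : t ∈ P
    · simp only [ht, if_true]
      exact (continuous_apply t).sub (hgt_cont t _ fun t' h => ih t' h)
    · simp only [ht, if_false]
      exact continuous_apply t
  set e : OpenPartialHomeomorph (T → ℝ) (T → ℝ) :=
    { toFun := Φ
      invFun := Ψ
      source := N
      target := Ψ ⁻¹' N
      map_source' := fun z hz => by rw [Set.mem_preimage, hΨΦ]; exact hz
      map_target' := fun y hy => hy
      left_inv' := fun z _ => hΨΦ z
      right_inv' := fun y _ => hΦΨ y
      open_source := hNo
      open_target := hNo.preimage hΨc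
      continuousOn_toFun := hΦc.continuousOn
      continuousOn_invFun := hΨc.continuousOn } with he
  have hΦN : ∀ z (hz : z ∈ N), ∀ t ∈ P, Φ z t = (F t).1 ⟨z, hNV z hz⟩ := by
    intro z hz t ht
    have h1 : Φ z t = z t + gt t (fun t' _ => z t') := if_pos ht
    rw [h1, hgt_N t ht z hz]
    change z t + ((F t).1 ⟨z, hNV z hz⟩ - z t) = _
    ring
  refine ⟨e, haN, fun t => ?_, fun t => ?_, P, ?_⟩
  · by_cases ht : t ∈ P
    · have h1 := comp_mem_smoothFunctions (W := ⟨e.source, e.open_source⟩) (V := V)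
        (fun z => ⟨z.1, hNV z.1 z.2⟩) (fun t => (coordFun _ t).2) (F t).2
      exact mem_smoothFunctions_of_eq h1 fun z => hΦN z.1 z.2 t ht
    · have h1 := (coordFun ⟨e.source, e.open_source⟩ t).2
      exact mem_smoothFunctions_of_eq h1 fun z => if_neg ht
  · induction t using hwf.induction with
    | h t ih =>
    by_cases ht : t ∈ P
    · have hmem : ∀ y : e.target, (fun t' => if rk t' < rk t then Ψ y.1 t' else a t') ∈ V := by
        intro y
        refine hBV _ fun t' => ?_
        split_ifs
        · exact (hN _ y.2 t').1
        · exact haB t'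
      have h1 := comp_mem_smoothFunctions (W := ⟨e.target, e.open_target⟩) (V := V)
        (fun y => ⟨_, hmem y⟩) (fun t' => ?_) (g t).2
      · have h2 := sub_mem (coordFun ⟨e.target, e.open_target⟩ t).2 h1
        refine mem_smoothFunctions_of_eq h2 fun y => ?_
        refine (hΨ_eq y.1 t).trans ?_
        rw [if_pos ht]
        refine congrArg (fun r => y.1 t - r) (congrArg (g t).1 (Subtype.ext (funext fun t' => ?_)))
        by_cases h : rk t' < rk t
        · simp only [h, dif_pos, if_true]
          exact (hN _ y.2 t').2
        · simp only [h, dif_neg, not_false_iff, if_false]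
      · by_cases h : rk t' < rk t
        · simp only [h, if_true]
          exact ih t' h
        · simp only [h, if_false]
          exact (algebraMap ℝ (smoothFunctions _) (a t')).2
    · have h1 := (coordFun ⟨e.target, e.open_target⟩ t).2
      exact mem_smoothFunctions_of_eq h1 fun y => (hΨ_eq y.1 t).trans (if_neg ht)
  · ext y
    constructor
    · rintro ⟨z, ⟨hz, hzV, hzF⟩, rfl⟩
      refine ⟨e.map_source hz, fun t ht => ?_⟩
      exact (hΦN z hz t ht).trans (hzF t ht)
    · rintro ⟨hy, hy0⟩
      have hy' : Ψ y ∈ N := hy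
      refine ⟨Ψ y, ⟨hy', hNV _ hy', fun t ht => ?_⟩, hΦΨ y⟩
      rw [← hΦN _ hy' t ht, hΦΨ]
      exact hy0 t ht

end Triangular

/-! ### Normalized generators of a triangular ideal -/

section NormalizedGenerators

variable {T : Type*} {V : TopologicalSpace.Opens (T → ℝ)}

/-- Every element of the ideal generated by `B` vanishes at the common zeros of `B`. -/
theorem apply_eq_zero_of_mem_span {B : Set (smoothFunctions V)} {z : V} (hz : ∀ b ∈ B, b.1 z = 0)
    {f : smoothFunctions V} (hf : f ∈ Ideal.span B) : f.1 z = 0 := by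
  refine Submodule.span_induction (p := fun f _ => f.1 z = 0) hz rfl ?_ ?_ hf
  · intro f g _ _ hf hg
    change f.1 z + g.1 z = 0
    rw [hf, hg, add_zero]
  · intro a f _ hf
    change a.1 z * f.1 z = 0
    rw [hf, mul_zero]

theorem span_ne_top_of_common_zero {B : Set (smoothFunctions V)} {z : V}
    (hz : ∀ b ∈ B, b.1 z = 0) : Ideal.span B ≠ ⊤ := by
  intro h
  have h1 : (1 : smoothFunctions V).1 z = 0 :=
    apply_eq_zero_of_mem_span hz (h ▸ Submodule.mem_top)
  exact one_ne_zero h1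

theorem isNormalizedWith_image_coordFun_sub [Nonempty T] [Nonempty V] {P : Set T}
    {h : T → smoothFunctions V} (hh : ∀ t ∈ P, h t ∈ indepOf V P) :
    IsNormalizedWith ((fun t => coordFun V t - h t) '' P) P := by
  have hinj : Set.InjOn (fun t => coordFun V t - h t) P := by
    intro t ht t' ht' e
    by_contra hne
    have h1 := congrArg (partialDeriv t) e
    simp only [partialDeriv_sub] at h1
    rw [partialDeriv_coordFun_self, partialDeriv_coordFun_of_ne (Ne.symm hne), hh t ht t ht,
      hh t' ht' t ht, sub_zero] at h1
    obtain ⟨z⟩ := ‹Nonempty V›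
    have h2 : (1 : ℝ) = 0 - 0 := congrFun (congrArg Subtype.val h1) z
    norm_num at h2
  have hinv : Set.LeftInvOn (Function.invFunOn (fun t => coordFun V t - h t) P)
    (fun t => coordFun V t - h t) P := hinj.leftInvOn_invFunOn
  refine ⟨Function.invFunOn (fun t => coordFun V t - h t) P, ⟨?_, ?_, ?_⟩, ?_⟩
  · rintro _ ⟨t, ht, rfl⟩
    rw [hinv ht]
    exact ht
  · rintro _ ⟨t, ht, rfl⟩ _ ⟨t', ht', rfl⟩ e
    rw [hinv ht, hinv ht'] at e
    rw [e]
  · intro t ht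
    exact ⟨_, ⟨t, ht, rfl⟩, hinv ht⟩
  · rintro _ ⟨t, ht, rfl⟩ l hl
    rw [hinv ht, sub_sub_cancel_left, not_dependsOnVar]
    exact neg_mem (hh t ht) l hl

/-- Two families generate the same ideal if members with the same index differ by a combination of
members of the second family of lower rank. -/
theorem span_image_eq_of_sub_mem_lower {R ι Γ : Type*} [CommRing R] [LinearOrder Γ]
    [WellFoundedLT Γ] (rk : ι → Γ) (P : Set ι) (a b : ι → R)
    (h : ∀ t ∈ P, a t - b t ∈ Ideal.span (b '' {s ∈ P | rk s < rk t})) :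
    Ideal.span (a '' P) = Ideal.span (b '' P) := by
  refine le_antisymm (Ideal.span_le.2 ?_) (Ideal.span_le.2 ?_)
  · rintro _ ⟨t, ht, rfl⟩
    have h1 := Ideal.span_mono (Set.image_mono (f := b) (Set.sep_subset P _)) (h t ht)
    have h2 := add_mem h1 (Ideal.subset_span ⟨t, ht, rfl⟩ : b t ∈ Ideal.span (b '' P))
    rwa [sub_add_cancel] at h2
  · have key : ∀ γ : Γ, ∀ t ∈ P, rk t = γ → b t ∈ Ideal.span (a '' P) := by
      intro γ
      induction γ using WellFoundedLT.induction with
      | ind γ ih =>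
        rintro t ht rfl
        have hle : Ideal.span (b '' {s ∈ P | rk s < rk t}) ≤ Ideal.span (a '' P) := by
          refine Ideal.span_le.2 ?_
          rintro _ ⟨s, ⟨hs, hst⟩, rfl⟩
          exact ih _ hst s hs rfl
        have h2 := sub_mem (Ideal.subset_span ⟨t, ht, rfl⟩ : a t ∈ Ideal.span (a '' P))
          (hle (h t ht))
        rwa [sub_sub_cancel] at h2
    rintro _ ⟨t, ht, rfl⟩
    exact key _ t ht rfl

/-- If the variables of rank below `t` can be eliminated from `F t - y_t` modulo arbitrary
equations `y_s = h_s` with `h_s` independent of `P`, then the ideal generated by the `F t`, `t ∈ P`,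
has normalized generators with the principal variables `P`. The `h_t` are found by recursion on the
rank. -/
theorem exists_normalized_generators {Γ : Type*} [LinearOrder Γ] [WellFoundedLT Γ]
    (rk : T → Γ) (P : Set T) (F : T → smoothFunctions V)
    (helim : ∀ t ∈ P, ∀ h : T → smoothFunctions V, (∀ s, h s ∈ indepOf V P) →
      ∃ c ∈ indepOf V P, F t - coordFun V t - c ∈
        Ideal.span ((fun s => coordFun V s - h s) '' {s ∈ P | rk s < rk t})) :
    ∃ h : T → smoothFunctions V, (∀ t, h t ∈ indepOf V P) ∧
      Ideal.span (F '' P) = Ideal.span ((fun t => coordFun V t - h t) '' P) := by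
  classical
  have hwf : WellFounded fun t t' : T => rk t < rk t' := InvImage.wf rk wellFounded_lt
  choose! c hc hcF using helim
  -- `h t` takes values in functions independent of `P`, so that elimination applies at every stage
  -- of the recursion; the values of rank not below `t` do not matter and are set to zero
  set h : T → indepOf V P := hwf.fix fun t w =>
    if ht : t ∈ P then
      ⟨-c t fun s => if hs : rk s < rk t then (w s hs).1 else 0, neg_mem (hc t ht _ fun s => by
        split_ifs with hs
        · exact (w s hs).2
        · exact zero_mem _)⟩
    else 0 with hdef
  have hh : ∀ t ∈ P, (h t).1 = -c t fun s => if rk s < rk t then (h s).1 else 0 := by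
    intro t ht
    rw [hdef, hwf.fix_eq, dif_pos ht]
    rfl
  refine ⟨fun t => (h t).1, fun t => (h t).2,
    span_image_eq_of_sub_mem_lower rk P _ _ fun t ht => ?_⟩
  have h1 := hcF t ht (fun s => if rk s < rk t then (h s).1 else 0) fun s => by
    split_ifs
    · exact (h s).2
    · exact zero_mem _
  have h2 : F t - (coordFun V t - (h t).1) =
      F t - coordFun V t - c t fun s => if rk s < rk t then (h s).1 else 0 := by
    rw [hh t ht]
    ring
  rw [h2]
  refine Ideal.span_mono ?_ h1
  rintro _ ⟨s, hs, rfl⟩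
  exact ⟨s, hs, by simp only [hs.2, if_true]⟩

/-! ### Elimination from polynomials -/

theorem Derivation.aeval_of_apply_eq_one {R : Type*} [CommRing R] [Algebra ℝ R]
    (d : Derivation ℝ R R) {z : R} (hz : d z = 1) {A : Subalgebra ℝ R} (hA : ∀ a ∈ A, d a = 0)
    (q : Polynomial A) :
    d (Polynomial.aeval z q) = Polynomial.aeval z (Polynomial.derivative q) := by
  induction q using Polynomial.induction_on' with
  | add p q hp hq => simp only [map_add, hp, hq]
  | monomial k a =>
    have ha : d (algebraMap A R a) = 0 := hA a.1 a.2
    rw [Polynomial.derivative_monomial, Polynomial.aeval_monomial, Polynomial.aeval_monomial,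
      d.leibniz, ha, smul_zero, add_zero, d.leibniz_pow, hz, map_mul, _root_.map_natCast]
    simp [mul_assoc]

/-- An element `z` with `d z = 1` is transcendental over the constants of `d`: differentiating a
relation lowers its degree. -/
theorem Derivation.eq_zero_of_aeval_eq_zero {R : Type*} [CommRing R] [Algebra ℝ R]
    (d : Derivation ℝ R R) {z : R} (hz : d z = 1) {A : Subalgebra ℝ R} (hA : ∀ a ∈ A, d a = 0)
    (q : Polynomial A) (hq : Polynomial.aeval z q = 0) : q = 0 := by
  let _ : Module ℚ A := Module.compHom A (algebraMap ℚ ℝ)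
  have : IsAddTorsionFree A := IsAddTorsionFree.of_module_rat A
  induction h : q.natDegree using Nat.strong_induction_on generalizing q with
  | h k ih =>
  have hd : Polynomial.derivative q = 0 := by
    by_cases hk : k = 0
    · rw [hk] at h
      rw [Polynomial.eq_C_of_natDegree_eq_zero h, Polynomial.derivative_C]
    · refine ih _ ?_ _ ?_ rfl
      · rw [← h]
        exact Polynomial.natDegree_derivative_lt (by rwa [h])
      · rw [← d.aeval_of_apply_eq_one hz hA, hq, map_zero]
  rw [Polynomial.eq_C_of_natDegree_eq_zero (Polynomial.derivative_eq_zero.1 hd)] at hq ⊢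
  rw [Polynomial.aeval_C] at hq
  have h0 : q.coeff 0 = 0 := Subtype.ext hq
  rw [h0, Polynomial.C_0]

/-- A polynomial in `z` over an algebra `A` of constants of a derivation `d` with `d z = 1` belongs
to `A` if `d` maps it to zero, because its formal derivative vanishes. -/
theorem Derivation.mem_of_mem_adjoin_insert {R : Type*} [CommRing R] [Algebra ℝ R]
    (d : Derivation ℝ R R) {z : R} (hz : d z = 1) {A : Subalgebra ℝ R} (hA : ∀ a ∈ A, d a = 0)
    {f : R} (hf : f ∈ Algebra.adjoin ℝ (insert z (A : Set R))) (hdf : d f = 0) : f ∈ A := by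
  let _ : Module ℚ A := Module.compHom A (algebraMap ℚ ℝ)
  have : IsAddTorsionFree A := IsAddTorsionFree.of_module_rat A
  have hle : Algebra.adjoin ℝ (insert z (A : Set R)) ≤
      ((Polynomial.aeval (R := A) z).restrictScalars ℝ).range := by
    refine Algebra.adjoin_le ?_
    rintro a (rfl | ha)
    · exact ⟨Polynomial.X, Polynomial.aeval_X _⟩
    · exact ⟨Polynomial.C ⟨a, ha⟩, Polynomial.aeval_C _ _⟩
  obtain ⟨q, hq⟩ := hle hf
  replace hq : Polynomial.aeval z q = f := hq
  rw [← hq, d.aeval_of_apply_eq_one hz hA] at hdf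
  have hd := d.eq_zero_of_aeval_eq_zero hz hA _ hdf
  rw [← hq, Polynomial.eq_C_of_natDegree_eq_zero (Polynomial.derivative_eq_zero.1 hd),
    Polynomial.aeval_C]
  exact (q.coeff 0).2

theorem isPolynomialIn_iff {P : Set T} {f : smoothFunctions V} : IsPolynomialIn P f ↔
    f ∈ Algebra.adjoin ℝ ((indepOf V P : Set (smoothFunctions V)) ∪ coordFun V '' P) := by
  have h : {c : smoothFunctions V | ∀ t ∈ P, ¬ DependsOnVar c t} = indepOf V P :=
    Set.ext fun c => forall₂_congr fun t _ => not_dependsOnVar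
  rw [IsPolynomialIn, h]

/-- A function polynomial in `P` is a polynomial in those variables of `P` on which it depends. -/
theorem IsPolynomialIn.mem_adjoin {P Q : Set T} {f : smoothFunctions V} (hf : IsPolynomialIn P f)
    (hfQ : ∀ t ∈ P, t ∉ Q → partialDeriv t f = 0) :
    f ∈ Algebra.adjoin ℝ ((indepOf V P : Set (smoothFunctions V)) ∪ coordFun V '' Q) := by
  classical
  set A : Set T → Subalgebra ℝ (smoothFunctions V) := fun Q =>
    Algebra.adjoin ℝ ((indepOf V P : Set (smoothFunctions V)) ∪ coordFun V '' Q) with hA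
  have hmono : ∀ {Q Q' : Set T}, Q ⊆ Q' → A Q ≤ A Q' := fun h =>
    Algebra.adjoin_mono (Set.union_subset_union_right _ (Set.image_mono h))
  have hfinite : ∃ d : Finset T, (d : Set T) ⊆ P ∧ f ∈ A (Q ∪ d) := by
    refine Algebra.adjoin_induction (p := fun f _ => ∃ d : Finset T, (d : Set T) ⊆ P ∧
      f ∈ A (Q ∪ d)) ?_ ?_ ?_ ?_ (isPolynomialIn_iff.1 hf)
    · rintro f (hf | ⟨t, ht, rfl⟩)
      · exact ⟨∅, by simp, Algebra.subset_adjoin (Or.inl hf)⟩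
      · exact ⟨{t}, by simpa using ht, Algebra.subset_adjoin (Or.inr ⟨t, by simp, rfl⟩)⟩
    · exact fun r => ⟨∅, by simp, algebraMap_mem _ _⟩
    · rintro f g _ _ ⟨d, hd, hf⟩ ⟨d', hd', hg⟩
      refine ⟨d ∪ d', by simp [hd, hd'], add_mem (hmono ?_ hf) (hmono ?_ hg)⟩ <;>
      · intro t; simp; tauto
    · rintro f g _ _ ⟨d, hd, hf⟩ ⟨d', hd', hg⟩
      refine ⟨d ∪ d', by simp [hd, hd'], mul_mem (hmono ?_ hf) (hmono ?_ hg)⟩ <;>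
      · intro t; simp; tauto
  obtain ⟨d, hdP, hfd⟩ := hfinite
  change f ∈ A Q
  induction d using Finset.induction_on with
  | empty => simpa using hfd
  | insert t d htd ih =>
    refine ih (fun s hs => hdP (by simp [Finset.mem_coe.1 hs])) ?_
    by_cases htQ : t ∈ Q
    · refine hmono ?_ hfd
      intro s
      simp only [Finset.coe_insert, Set.mem_union, Set.mem_insert_iff]
      rintro (h | rfl | h)
      exacts [Or.inl h, Or.inl htQ, Or.inr h]
    · have htP : t ∈ P := hdP (by simp)
      have hAt : A (Q ∪ d) ≤ indepOf V {t} := by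
        refine Algebra.adjoin_le ?_
        rintro c (hc | ⟨s, hs, rfl⟩)
        · exact indepOf_anti (by simpa using htP) hc
        · refine coordFun_mem_indepOf ?_
          rintro rfl
          rcases hs with hs | hs
          exacts [htQ hs, htd hs]
      refine (partialDerivation V t).mem_of_mem_adjoin_insert (partialDeriv_coordFun_self t)
        (fun a ha => hAt ha t rfl) ?_ (hfQ t htP htQ)
      refine Algebra.adjoin_le ?_ hfd
      rintro c (hc | ⟨s, hs, rfl⟩)
      · exact Algebra.subset_adjoin (Or.inr (Algebra.subset_adjoin (Or.inl hc)))
      · simp only [Finset.coe_insert, Set.mem_union, Set.mem_insert_iff] at hs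
        rcases hs with hs | rfl | hs
        · exact Algebra.subset_adjoin
            (Or.inr (Algebra.subset_adjoin (Or.inr ⟨s, Or.inl hs, rfl⟩)))
        · exact Algebra.subset_adjoin (Or.inl rfl)
        · exact Algebra.subset_adjoin
            (Or.inr (Algebra.subset_adjoin (Or.inr ⟨s, Or.inr hs, rfl⟩)))

/-- Elimination of the variables `Q` from a polynomial by means of the equations `y_s = h_s`. -/
theorem exists_sub_mem_of_mem_adjoin {P Q : Set T} {h : T → smoothFunctions V}
    (hh : ∀ s, h s ∈ indepOf V P) {f : smoothFunctions V}
    (hf : f ∈ Algebra.adjoin ℝ ((indepOf V P : Set (smoothFunctions V)) ∪ coordFun V '' Q)) :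
    ∃ c ∈ indepOf V P, f - c ∈ Ideal.span ((fun s => coordFun V s - h s) '' Q) := by
  refine Algebra.adjoin_induction (p := fun f _ => ∃ c ∈ indepOf V P,
    f - c ∈ Ideal.span ((fun s => coordFun V s - h s) '' Q)) ?_ ?_ ?_ ?_ hf
  · rintro f (hf | ⟨t, ht, rfl⟩)
    · exact ⟨f, hf, by rw [sub_self]; exact zero_mem _⟩
    · exact ⟨h t, hh t, Ideal.subset_span ⟨t, ht, rfl⟩⟩
  · exact fun r => ⟨_, algebraMap_mem _ r, by rw [sub_self]; exact zero_mem _⟩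
  · rintro f g _ _ ⟨c, hc, hf⟩ ⟨c', hc', hg⟩
    refine ⟨c + c', add_mem hc hc', ?_⟩
    rw [add_sub_add_comm]
    exact add_mem hf hg
  · rintro f g _ _ ⟨c, hc, hf⟩ ⟨c', hc', hg⟩
    refine ⟨c * c', mul_mem hc hc', ?_⟩
    have e : f * g - c * c' = f * (g - c') + c' * (f - c) := by ring
    rw [e]
    exact add_mem (Ideal.mul_mem_left _ _ hg) (Ideal.mul_mem_left _ _ hf)

end NormalizedGenerators

section PolynomialOrbit

variable {n m : ℕ} {V : TopologicalSpace.Opens (JetSpace n m)}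

theorem isPolynomialIn_totalDerivCoord (P : Set (JetIndex n m)) (i : Fin n) (t : JetIndex n m) :
    IsPolynomialIn P (totalDerivCoord V i t) := by
  rw [isPolynomialIn_iff]
  rcases t with k | u
  · simp only [totalDerivCoord]
    split_ifs
    · exact one_mem _
    · exact zero_mem _
  · by_cases hu : Sum.inr (shiftVar (Pi.single i 1) u) ∈ P
    · exact Algebra.subset_adjoin (Or.inr ⟨_, hu, rfl⟩)
    · exact Algebra.subset_adjoin (Or.inl (coordFun_mem_indepOf hu))

theorem IsPolynomialIn.totalDeriv {P : Set (JetIndex n m)} {f : smoothFunctions V}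
    (hf : IsPolynomialIn P f) (i : Fin n) : IsPolynomialIn P (totalDeriv i f) := by
  have hc := fun t => isPolynomialIn_iff.1 (isPolynomialIn_totalDerivCoord (V := V) P i t)
  rw [isPolynomialIn_iff] at hf ⊢
  have hind : ∀ f ∈ indepOf V P, _root_.totalDeriv i f ∈ Algebra.adjoin ℝ
      ((indepOf V P : Set (smoothFunctions V)) ∪ coordFun V '' P) := by
    intro f hf
    obtain ⟨s, hs⟩ := exists_finset_partialDeriv_eq_zero f
    rw [totalDeriv_eq_sum i hs]
    exact sum_mem fun t _ => mul_mem
      (Algebra.subset_adjoin (Or.inl (partialDeriv_mem_indepOf hf t))) (hc t)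
  refine Algebra.adjoin_induction (p := fun f _ => _root_.totalDeriv i f ∈ Algebra.adjoin ℝ
      ((indepOf V P : Set (smoothFunctions V)) ∪ coordFun V '' P)) ?_ ?_ ?_ ?_ hf
  · rintro f (hf | ⟨t, ht, rfl⟩)
    · exact hind f hf
    · rw [totalDeriv_coordFun]
      exact hc t
  · exact fun r => hind _ (algebraMap_mem _ r)
  · intro f g _ _ hf hg
    rw [totalDeriv_add]
    exact add_mem hf hg
  · intro f g hf hg hDf hDg
    rw [totalDeriv_mul]
    exact add_mem (mul_mem hf hDg) (mul_mem hg hDf)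

theorem IsPolynomialIn.totalDerivMulti {P : Set (JetIndex n m)} {f : smoothFunctions V}
    (hf : IsPolynomialIn P f) (δ : Fin n → ℕ) : IsPolynomialIn P (totalDerivMulti δ f) := by
  induction δ using multiIndex_induction with
  | h0 => rwa [totalDerivMulti_zero]
  | hs δ i ih =>
    rw [totalDerivMulti_add_single]
    exact ih.totalDeriv i

end PolynomialOrbit

/-! ### Smoothness of integrals depending on parameters -/

section ParametricIntegral

open Set Metric

universe u

variable {E : Type u} [NormedAddCommGroup E] [ProperSpace E]

/-- The local bound needed to differentiate under the integral sign. -/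
theorem exists_closedBall_bound {G : Type u} [NormedAddCommGroup G] {Φ : E × ℝ → G}
    {O : Set (E × ℝ)} {Ω : Set E} (hΩ : IsOpen Ω)
    (hsub : ∀ x ∈ Ω, ∀ τ ∈ Icc (0 : ℝ) 1, (x, τ) ∈ O) (hΦ : ContinuousOn Φ O) {x₀ : E}
    (hx₀ : x₀ ∈ Ω) : ∃ ε > 0, closedBall x₀ ε ⊆ Ω ∧
      ∃ C, ∀ x ∈ closedBall x₀ ε, ∀ τ ∈ Icc (0 : ℝ) 1, ‖Φ (x, τ)‖ ≤ C := by
  obtain ⟨ε, hε, hεΩ⟩ := nhds_basis_closedBall.mem_iff.1 (hΩ.mem_nhds hx₀)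
  obtain ⟨C, hC⟩ := ((isCompact_closedBall x₀ ε).prod
    (isCompact_Icc (a := (0 : ℝ)) (b := 1))).exists_bound_of_continuousOn
    (hΦ.mono fun p hp => hsub p.1 (hεΩ hp.1) p.2 hp.2)
  exact ⟨ε, hε, hεΩ, C, fun x hx τ hτ => hC (x, τ) ⟨hx, hτ⟩⟩

variable [NormedSpace ℝ E]

theorem ContDiffOn.parametric_intervalIntegral {k : ℕ} {G : Type u} [NormedAddCommGroup G]
    [NormedSpace ℝ G] {Φ : E × ℝ → G} {O : Set (E × ℝ)} (hO : IsOpen O) {Ω : Set E}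
    (hΩ : IsOpen Ω) (hsub : ∀ x ∈ Ω, ∀ τ ∈ Icc (0 : ℝ) 1, (x, τ) ∈ O)
    (hΦ : ContDiffOn ℝ k Φ O) :
    ContDiffOn ℝ k (fun x => ∫ τ in (0 : ℝ)..1, Φ (x, τ)) Ω := by
  have huIoc : ∀ τ, τ ∈ uIoc (0 : ℝ) 1 → τ ∈ Icc (0 : ℝ) 1 := by
    intro τ hτ
    rw [uIoc_of_le zero_le_one] at hτ
    exact Ioc_subset_Icc_self hτ
  have hslice : ∀ {G : Type u} [NormedAddCommGroup G] {Φ : E × ℝ → G}, ContinuousOn Φ O →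
      ∀ x ∈ Ω, ContinuousOn (fun τ => Φ (x, τ)) (Icc (0 : ℝ) 1) := by
    intro G _ Φ hΦ x hx
    exact hΦ.comp (by fun_prop) fun τ hτ => hsub x hx τ hτ
  have hmeas : ∀ {G : Type u} [NormedAddCommGroup G] {Φ : E × ℝ → G}, ContinuousOn Φ O →
      ∀ x ∈ Ω, MeasureTheory.AEStronglyMeasurable (fun τ => Φ (x, τ))
        (MeasureTheory.volume.restrict (uIoc (0 : ℝ) 1)) := by
    intro G _ Φ hΦ x hx
    exact ((hslice hΦ x hx).mono huIoc).aestronglyMeasurable measurableSet_uIoc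
  induction k generalizing G with
  | zero =>
    have hc : ContinuousOn Φ O := hΦ.continuousOn
    rw [Nat.cast_zero, contDiffOn_zero]
    intro x₀ hx₀
    obtain ⟨ε, hε, hεΩ, C, hC⟩ := exists_closedBall_bound hΩ hsub hc hx₀
    refine (intervalIntegral.continuousAt_of_dominated_interval (bound := fun _ => C) ?_ ?_ ?_
      ?_).continuousWithinAt
    · filter_upwards [hΩ.mem_nhds hx₀] with x hx using hmeas hc x hx
    · filter_upwards [closedBall_mem_nhds x₀ hε] with x hx
      exact Filter.Eventually.of_forall fun τ hτ => hC x hx τ (huIoc τ hτ)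
    · exact intervalIntegrable_const
    · refine Filter.Eventually.of_forall fun τ hτ => ?_
      have h1 : ContinuousAt Φ (x₀, τ) :=
        hc.continuousAt (hO.mem_nhds (hsub x₀ hx₀ τ (huIoc τ hτ)))
      exact ContinuousAt.comp (g := Φ) h1 (by fun_prop)
  | succ k ih =>
    have hc : ContinuousOn Φ O := hΦ.continuousOn
    have h1 : ContDiffOn ℝ (k + 1 : ℕ∞ω) Φ O := by exact_mod_cast hΦ
    obtain ⟨hd, -, hD⟩ := (contDiffOn_succ_iff_fderiv_of_isOpen hO).1 h1
    set Φ' : E × ℝ → E →L[ℝ] G := fun p => (fderiv ℝ Φ p).comp (ContinuousLinearMap.inl ℝ E ℝ)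
    have hΦ' : ContDiffOn ℝ k Φ' O := hD.clm_comp contDiffOn_const
    have hc' : ContinuousOn Φ' O := hΦ'.continuousOn
    have hder : ∀ x ∈ Ω, HasFDerivAt (fun x => ∫ τ in (0 : ℝ)..1, Φ (x, τ))
        (∫ τ in (0 : ℝ)..1, Φ' (x, τ)) x := by
      intro x₀ hx₀
      obtain ⟨ε, hε, hεΩ, C, hC⟩ := exists_closedBall_bound hΩ hsub hc' hx₀
      refine intervalIntegral.hasFDerivAt_integral_of_dominated_of_fderiv_le
        (F := fun x τ => Φ (x, τ)) (F' := fun x τ => Φ' (x, τ)) (bound := fun _ => C)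
        (closedBall_mem_nhds x₀ hε) ?_ ?_ (hmeas hc' x₀ hx₀) ?_ intervalIntegrable_const ?_
      · filter_upwards [hΩ.mem_nhds hx₀] with x hx using hmeas hc x hx
      · refine ContinuousOn.intervalIntegrable ?_
        rw [uIcc_of_le zero_le_one]
        exact hslice hc x₀ hx₀
      · exact Filter.Eventually.of_forall fun τ hτ x hx => hC x hx τ (huIoc τ hτ)
      · refine Filter.Eventually.of_forall fun τ hτ x hx => ?_
        have h2 : HasFDerivAt Φ (fderiv ℝ Φ (x, τ)) (x, τ) :=
          (hd.differentiableAt (hO.mem_nhds (hsub x (hεΩ hx) τ (huIoc τ hτ)))).hasFDerivAt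
        exact h2.comp x (hasFDerivAt_prodMk_left x τ)
    have hgoal : ContDiffOn ℝ (k + 1 : ℕ∞ω) (fun x => ∫ τ in (0 : ℝ)..1, Φ (x, τ)) Ω := by
      refine (contDiffOn_succ_iff_fderiv_of_isOpen hΩ).2
        ⟨fun x hx => (hder x hx).differentiableAt.differentiableWithinAt, by simp, ?_⟩
      exact (ih hΦ').congr fun x hx => (hder x hx).fderiv
    exact_mod_cast hgoal

theorem contDiffAt_parametric_intervalIntegral {G : Type u} [NormedAddCommGroup G]
    [NormedSpace ℝ G] {Φ : E × ℝ → G} {x₀ : E}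
    (h : ∀ τ ∈ Icc (0 : ℝ) 1, ContDiffAt ℝ ∞ Φ (x₀, τ)) :
    ContDiffAt ℝ ∞ (fun x => ∫ τ in (0 : ℝ)..1, Φ (x, τ)) x₀ := by
  rw [contDiffAt_infty]
  intro k
  have hO : IsOpen {p | ContDiffAt ℝ k Φ p} := by
    rw [isOpen_iff_mem_nhds]
    intro p hp
    exact ContDiffAt.eventually hp (by simp)
  obtain ⟨Ω, W, hΩ, -, hx₀, hW, hsub⟩ := generalized_tube_lemma (isCompact_singleton (x := x₀))
    (isCompact_Icc (a := (0 : ℝ)) (b := 1)) hO (by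
      rintro ⟨x, τ⟩ ⟨rfl, hτ⟩
      exact contDiffAt_infty.1 (h τ hτ) k)
  refine (ContDiffOn.parametric_intervalIntegral hO hΩ
    (fun x hx τ hτ => hsub ⟨hx, hW hτ⟩) fun p hp => ContDiffAt.contDiffWithinAt hp).contDiffAt
    (hΩ.mem_nhds (hx₀ rfl))

end ParametricIntegral

/-! ### Elimination on domains of the form `W × ℝ^P` -/

section Saturated

variable {T : Type} {V : TopologicalSpace.Opens (T → ℝ)}

/-- The open set `V × ℝ`, the additional coordinate having the index `none`. -/
def optionProd (V : TopologicalSpace.Opens (T → ℝ)) : TopologicalSpace.Opens (Option T → ℝ) :=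
  ⟨{w | (fun t => w (some t)) ∈ V},
    V.isOpen.preimage (continuous_pi fun t => continuous_apply (some t))⟩

/-- `∫₀¹ f(z, τ) dτ` is a smooth function of finitely many coordinates of `z` if `f` is one of
finitely many coordinates of `(z, τ)`. -/
theorem intervalIntegral_mem_smoothFunctions {f : optionProd V → ℝ}
    (hf : f ∈ smoothFunctions (optionProd V)) :
    (fun z : V => ∫ τ in (0 : ℝ)..1, f ⟨fun t => t.elim τ z.1, z.2⟩) ∈ smoothFunctions V := by
  classical
  obtain ⟨s, F, hF⟩ := hf
  let L : ((Finset.eraseNone s → ℝ) × ℝ) → s → ℝ := fun p i =>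
    match i with
    | ⟨none, _⟩ => p.2
    | ⟨some t, ht⟩ => p.1 ⟨t, Finset.mem_eraseNone.2 ht⟩
  have hL : ContDiff ℝ ∞ L := by
    refine contDiff_pi.2 ?_
    rintro ⟨_ | t, ht⟩
    · exact contDiff_snd
    · exact (contDiff_apply ℝ ℝ _).comp contDiff_fst
  have hLz : ∀ (z : V) (τ : ℝ), L ((Finset.eraseNone s).restrict z.1, τ) =
      s.restrict (fun t : Option T => t.elim τ z.1) := by
    intro z τ
    funext i
    rcases i with ⟨_ | t, ht⟩ <;> rfl
  refine ⟨Finset.eraseNone s, fun y => ∫ τ in (0 : ℝ)..1, F (L (y, τ)), fun z => ⟨?_, ?_⟩⟩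
  · refine contDiffAt_parametric_intervalIntegral (Φ := fun p => F (L p)) fun τ _ => ?_
    refine ContDiffAt.comp (g := F) _ ?_ hL.contDiffAt
    rw [hLz]
    exact (hF ⟨fun t => t.elim τ z.1, z.2⟩).1
  · simp only [hLz]
    exact intervalIntegral.integral_congr fun τ _ => (hF ⟨fun t => t.elim τ z.1, z.2⟩).2

/-- `V` has the form `W × ℝ^P`: membership of a point is not affected by its coordinates in `P`. -/
def IsSaturated (V : TopologicalSpace.Opens (T → ℝ)) (P : Set T) : Prop :=
  ∀ z ∈ V, ∀ z' : T → ℝ, (∀ t, t ∉ P → z' t = z t) → z' ∈ V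

/-- On `W × ℝ^P` the vanishing of `∂f/∂y_t` for `t ∈ Q ⊆ P` is actual independence of the
coordinates in `Q`, the lines in these directions being contained in the domain. -/
theorem IsSaturated.apply_eq {P : Set T} (hV : IsSaturated V P) {Q : Set T} (hQ : Q ⊆ P)
    {f : smoothFunctions V} (hf : f ∈ indepOf V Q) {z z' : V}
    (h : ∀ t, t ∉ Q → z.1 t = z'.1 t) : f.1 z = f.1 z' := by
  classical
  refine apply_eq_of_eqOn_compl hf (B := fun t => if t ∈ Q then Set.univ else {z.1 t})
    (fun t => ?_) (fun w hw => hV z.1 z.2 w fun t ht => ?_) (fun t => ?_) (fun t => ?_) h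
  · split_ifs
    · exact Set.ordConnected_univ
    · exact Set.ordConnected_singleton
  · have := hw t
    rw [if_neg fun h => ht (hQ h)] at this
    exact this
  · split_ifs <;> simp
  · split_ifs with ht
    · trivial
    · exact (h t ht).symm

open Classical in
theorem partialDeriv_eq_zero_of_update {f : smoothFunctions V} {t : T}
    (h : ∀ (z : V) (r : ℝ) (hr : Function.update z.1 t r ∈ V), f.1 ⟨_, hr⟩ = f.1 z) :
    partialDeriv t f = 0 := by
  refine Subtype.ext (funext fun z => ?_)
  have hcont : Continuous (fun r : ℝ => Function.update z.1 t r) :=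
    continuous_const.update t continuous_id
  have hmem : ∀ᶠ r in nhds (z.1 t), Function.update z.1 t r ∈ V := by
    apply hcont.continuousAt.eventually_mem
    rw [Function.update_eq_self]
    exact V.isOpen.mem_nhds z.2
  refine (hasDerivAt_sliceAt_self t f z).unique ?_
  refine (hasDerivAt_const (z.1 t) (f.1 z)).congr_of_eventuallyEq ?_
  filter_upwards [hmem] with r hr
  rw [sliceAt_of_mem hr]
  exact h z r hr

open Classical in
theorem IsSaturated.update_mem {P : Set T} (hV : IsSaturated V P) {t : T} (ht : t ∈ P) (z : V)
    (r : ℝ) : Function.update z.1 t r ∈ V :=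
  hV z.1 z.2 _ fun s hs => Function.update_of_ne (by rintro rfl; exact hs ht) _ _

open Classical in
/-- Hadamard's lemma: replacing the variable `y_t` by a function `h` not depending on it changes
`f` by a multiple of `y_t - h`, the quotient being `∫₀¹ ∂f/∂y_t (…, h + τ (y_t - h), …) dτ`. -/
theorem IsSaturated.exists_sub_eq_mul {P : Set T} (hV : IsSaturated V P) {t : T} (ht : t ∈ P)
    {h : smoothFunctions V} (hh : h ∈ indepOf V P) (f : smoothFunctions V) :
    ∃ f' q : smoothFunctions V, f - f' = q * (coordFun V t - h) ∧ partialDeriv t f' = 0 ∧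
      ∀ s ∈ P, partialDeriv s f = 0 → partialDeriv s f' = 0 := by
  have hsub : ∀ (z : V) (r : ℝ), Function.update z.1 t r ∈ V := hV.update_mem ht
  have hf' : (fun z : V => f.1 ⟨_, hsub z (h.1 z)⟩) ∈ smoothFunctions V := by
    refine comp_mem_smoothFunctions (fun z : V => ⟨_, hsub z (h.1 z)⟩) (fun s => ?_) f.2
    by_cases hs : s = t
    · subst hs
      exact mem_smoothFunctions_of_eq h.2 fun z => by simp only [Function.update_self]
    · exact mem_smoothFunctions_of_eq (coordFun V s).2 fun z => Function.update_of_ne hs _ _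
  have hq : (fun z : V => ∫ τ in (0 : ℝ)..1,
      (partialDeriv t f).1 ⟨_, hsub z (h.1 z + τ * (z.1 t - h.1 z))⟩) ∈ smoothFunctions V := by
    let π : optionProd V → V := fun w => ⟨fun s => w.1 (some s), w.2⟩
    have hπ : ∀ g : smoothFunctions V, (fun w => g.1 (π w)) ∈ smoothFunctions (optionProd V) :=
      fun g => comp_mem_smoothFunctions π (fun s => (coordFun (optionProd V) (some s)).2) g.2
    refine intervalIntegral_mem_smoothFunctions (f := fun w => (partialDeriv t f).1
      ⟨_, hsub (π w) (h.1 (π w) + w.1 none * ((π w).1 t - h.1 (π w)))⟩) ?_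
    refine comp_mem_smoothFunctions (fun w : optionProd V =>
      ⟨_, hsub (π w) (h.1 (π w) + w.1 none * ((π w).1 t - h.1 (π w)))⟩)
      (fun s => ?_) (partialDeriv t f).2
    by_cases hs : s = t
    · subst hs
      refine mem_smoothFunctions_of_eq (add_mem (hπ h) (mul_mem (coordFun (optionProd V) none).2
        (sub_mem (hπ (coordFun V s)) (hπ h)))) fun w => ?_
      simp only [Function.update_self]
      rfl
    · exact mem_smoothFunctions_of_eq (hπ (coordFun V s)) fun w => Function.update_of_ne hs _ _
  refine ⟨⟨_, hf'⟩, ⟨_, hq⟩, Subtype.ext (funext fun z => ?_), ?_, ?_⟩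
  · change f.1 z - f.1 ⟨_, hsub z (h.1 z)⟩ = (∫ τ in (0 : ℝ)..1,
      (partialDeriv t f).1 ⟨_, hsub z (h.1 z + τ * (z.1 t - h.1 z))⟩) * (z.1 t - h.1 z)
    have hd : ∀ τ ∈ Set.uIcc (0 : ℝ) 1, HasDerivAt
        (fun τ => sliceAt t f.1 z.1 (h.1 z + τ * (z.1 t - h.1 z)))
        ((partialDeriv t f).1 ⟨_, hsub z (h.1 z + τ * (z.1 t - h.1 z))⟩ * (z.1 t - h.1 z)) τ := by
      intro τ _
      refine HasDerivAt.comp τ (hasDerivAt_sliceAt t f z.1 _ (hsub z _)) ?_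
      have := ((hasDerivAt_id τ).mul_const (z.1 t - h.1 z)).const_add (h.1 z)
      rwa [one_mul] at this
    have hcont : Continuous fun τ : ℝ =>
        (partialDeriv t f).1 ⟨_, hsub z (h.1 z + τ * (z.1 t - h.1 z))⟩ * (z.1 t - h.1 z) := by
      refine Continuous.mul ?_ continuous_const
      refine (continuous_of_mem_smoothFunctions (partialDeriv t f).2).comp
        (Continuous.subtype_mk ?_ _)
      exact continuous_const.update t (by fun_prop)
    have hint := intervalIntegral.integral_eq_sub_of_hasDerivAt hd (hcont.intervalIntegrable 0 1)
    rw [intervalIntegral.integral_mul_const] at hint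
    rw [hint]
    simp only [one_mul, zero_mul, add_zero, add_sub_cancel]
    rw [sliceAt_of_mem (hsub z (z.1 t)), sliceAt_of_mem (hsub z (h.1 z))]
    exact congrArg (fun w => f.1 w - f.1 ⟨_, hsub z (h.1 z)⟩)
      (Subtype.ext (Function.update_eq_self _ _).symm)
  · refine partialDeriv_eq_zero_of_update fun z r hr => ?_
    have hhz : h.1 ⟨_, hr⟩ = h.1 z := hV.apply_eq subset_rfl hh fun s hs => by
      have hne : s ≠ t := by rintro rfl; exact hs ht
      exact Function.update_of_ne hne _ _
    refine congrArg f.1 (Subtype.ext ?_)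
    change Function.update (Function.update z.1 t r) t (h.1 ⟨_, hr⟩) = Function.update z.1 t (h.1 z)
    rw [hhz, Function.update_idem]
  · intro s hs hfs
    refine partialDeriv_eq_zero_of_update fun z r hr => ?_
    have hhz : h.1 ⟨_, hr⟩ = h.1 z := hV.apply_eq subset_rfl hh fun s' hs' => by
      have hne : s' ≠ s := by rintro rfl; exact hs' hs
      exact Function.update_of_ne hne _ _
    change f.1 ⟨_, hsub ⟨_, hr⟩ (h.1 ⟨_, hr⟩)⟩ = f.1 ⟨_, hsub z (h.1 z)⟩
    refine hV.apply_eq (Q := {s}) (by simpa using hs) (by rintro _ rfl; exact hfs) fun s' hs' => ?_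
    have hne : s' ≠ s := hs'
    change Function.update (Function.update z.1 s r) t (h.1 ⟨_, hr⟩) s' =
      Function.update z.1 t (h.1 z) s'
    by_cases e : s' = t
    · subst e
      rw [Function.update_self, Function.update_self, hhz]
    · rw [Function.update_of_ne e, Function.update_of_ne e, Function.update_of_ne hne]

/-- Elimination of the variables `Q` from a smooth function by means of the equations
`y_s = h_s`, one variable at a time. -/
theorem IsSaturated.exists_sub_mem {P Q : Set T} (hV : IsSaturated V P) (hQ : Q ⊆ P)
    {h : T → smoothFunctions V} (hh : ∀ s, h s ∈ indepOf V P) {f : smoothFunctions V}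
    (hf : ∀ t ∈ P, t ∉ Q → partialDeriv t f = 0) :
    ∃ c ∈ indepOf V P, f - c ∈ Ideal.span ((fun s => coordFun V s - h s) '' Q) := by
  classical
  have key : ∀ d : Finset T, ∀ f : smoothFunctions V,
      (∀ t ∈ P, t ∉ Q → partialDeriv t f = 0) → (∀ t ∈ P, t ∉ d → partialDeriv t f = 0) →
      ∃ c ∈ indepOf V P, f - c ∈ Ideal.span ((fun s => coordFun V s - h s) '' Q) := by
    intro d
    induction d using Finset.induction_on with
    | empty =>
      intro f _ hd
      exact ⟨f, fun t ht => hd t ht (Finset.notMem_empty t), by rw [sub_self]; exact zero_mem _⟩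
    | insert t d _ ih =>
      intro f hf hd
      by_cases htQ : t ∈ Q
      · obtain ⟨f', q, hfq, hft, hfs⟩ := hV.exists_sub_eq_mul (hQ htQ) (hh t) f
        obtain ⟨c, hc, hfc⟩ := ih f' (fun s hs hsQ => hfs s hs (hf s hs hsQ)) fun s hs hsd => by
          by_cases e : s = t
          · exact e ▸ hft
          · exact hfs s hs (hd s hs (by simp [e, hsd]))
        refine ⟨c, hc, ?_⟩
        rw [← sub_add_sub_cancel f f' c, hfq]
        exact add_mem (Ideal.mul_mem_left _ _ (Ideal.subset_span ⟨t, htQ, rfl⟩)) hfc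
      · refine ih f hf fun s hs hsd => ?_
        by_cases e : s = t
        · exact hf s hs (e ▸ htQ)
        · exact hd s hs (by simp [e, hsd])
  obtain ⟨s, hs⟩ := exists_finset_partialDeriv_eq_zero f
  exact key s f hf fun t _ ht => hs t ht

/-- On a non-empty domain `W × ℝ^P` the equations `y_t = h_t`, `t ∈ P`, with `h_t` independent of
`P` have a common solution. -/
theorem IsSaturated.exists_common_zero {P : Set T} (hV : IsSaturated V P) (z₀ : V)
    {h : T → smoothFunctions V} (hh : ∀ s, h s ∈ indepOf V P) :
    ∃ z : V, ∀ b ∈ (fun s => coordFun V s - h s) '' P, b.1 z = 0 := by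
  classical
  have hz : (fun t => if t ∈ P then (h t).1 z₀ else z₀.1 t) ∈ V :=
    hV z₀.1 z₀.2 _ fun t ht => if_neg ht
  refine ⟨⟨_, hz⟩, ?_⟩
  rintro _ ⟨t, ht, rfl⟩
  change (if t ∈ P then (h t).1 z₀ else z₀.1 t) - (h t).1 ⟨_, hz⟩ = 0
  rw [if_pos ht, sub_eq_zero]
  exact hV.apply_eq subset_rfl (hh t) fun s hs => (if_neg hs).symm

end Saturated

/-! ### Manifold property and passivity -/

section Passivity

variable {n m : ℕ} {Γ : Type*} [LinearOrder Γ] {V : TopologicalSpace.Opens (JetSpace n m)}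
  {lvl : JetVar n m → Γ} {S : Set (smoothFunctions V)} {lt : smoothFunctions V → JetVar n m}

/-- The rank of a coordinate of the jet space: the level of its block for `u^i_α`, and the bottom
element for `x_1, …, x_n`. -/
def jetRank (lvl : JetVar n m → Γ) : JetIndex n m → WithBot Γ
  | Sum.inl _ => ⊥
  | Sum.inr u => lvl u

theorem setOf_not_jetRank_lt_eq_upperVars (lvl : JetVar n m → Γ) (v : JetVar n m) :
    {t | ¬ jetRank lvl t < jetRank lvl (Sum.inr v)} = upperVars lvl (lvl v) := by
  ext t
  rcases t with k | u
  · simp [jetRank, upperVars]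
  · simp [jetRank, upperVars]

/-- `exists_triangular_generators` for families indexed by all coordinates of the jet space; the
members outside the orbit of the leading terms play no role. -/
theorem exists_triangular_family [WellFoundedLT Γ] (hlvl : IsStratification lvl)
    (hlt : ∀ f ∈ S, IsOrderlySolvable lvl f (lt f)) (hred : SatisfiesReducibility lvl S lt) :
    ∃ F : JetIndex n m → smoothFunctions V,
      (∀ t ∈ Sum.inr '' varOrbit (lt '' S), F t ∈ diffOrbit S ∧
        F t - coordFun V t ∈ indepOf V {t' | ¬ jetRank lvl t' < jetRank lvl t}) ∧
      Ideal.span (diffOrbit S) = Ideal.span (F '' (Sum.inr '' varOrbit (lt '' S))) := by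
  obtain ⟨F, hF, hspan⟩ := exists_triangular_generators hlvl hlt hred
  refine ⟨Sum.elim (fun _ => 0) F, ?_, ?_⟩
  · rintro _ ⟨v, hv, rfl⟩
    rw [setOf_not_jetRank_lt_eq_upperVars]
    exact hF v hv
  · rw [Set.image_image]
    exact hspan

theorem orbitZeroSet_eq_of_span_eq {F : JetIndex n m → smoothFunctions V} {P : Set (JetIndex n m)}
    (h : Ideal.span (diffOrbit S) = Ideal.span (F '' P)) :
    orbitZeroSet S = {z | ∃ hz : z ∈ V, ∀ t ∈ P, (F t).1 ⟨z, hz⟩ = 0} := by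
  ext z
  refine exists_congr fun hz => ⟨fun hS t ht => ?_, fun hP f hf => ?_⟩
  · exact apply_eq_zero_of_mem_span hS (h ▸ Ideal.subset_span ⟨t, ht, rfl⟩)
  · refine apply_eq_zero_of_mem_span (B := F '' P) ?_ (h ▸ Ideal.subset_span hf)
    rintro _ ⟨t, ht, rfl⟩
    exact hP t ht

theorem IsOrderlySolvable.isSolvableFor (hlvl : IsStratification lvl) {f : smoothFunctions V}
    {u : JetVar n m} (hf : IsOrderlySolvable lvl f u) : IsSolvableFor f u :=
  fun δ hδ => absurd (hf _ hδ) (not_lt.2 (hlvl.lvl_le_shiftVar δ u))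

/-- Passivity from normalized generators `y_t - h_t` of `⟨⟨S⟩⟩`. -/
theorem isPassive_of_normalized_generators (hlvl : IsStratification lvl)
    (hlt : ∀ f ∈ S, IsOrderlySolvable lvl f (lt f)) {h : JetIndex n m → smoothFunctions V}
    (hh : ∀ t, h t ∈ indepOf V (Sum.inr '' varOrbit (lt '' S)))
    (hspan : Ideal.span (diffOrbit S) =
      Ideal.span ((fun t => coordFun V t - h t) '' (Sum.inr '' varOrbit (lt '' S))))
    (hne : (V : Set (JetSpace n m)).Nonempty) (htop : Ideal.span (diffOrbit S) ≠ ⊤) :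
    IsPassive S lt := by
  have : Nonempty V := hne.to_subtype
  have : Nonempty (JetIndex n m) := ⟨Sum.inr (lt 0)⟩
  exact ⟨fun f hf => (hlt f hf).isSolvableFor hlvl, htop, _,
    isNormalizedWith_image_coordFun_sub fun t _ => hh t, hspan.symm⟩

end Passivity

theorem theorem5p2 {n m : ℕ} {Γ : Type*} [LinearOrder Γ] [WellFoundedLT Γ]
    (lvl : JetVar n m → Γ) (hlvl : IsStratification lvl)
    (V : TopologicalSpace.Opens (JetSpace n m))
    (S : Set (smoothFunctions V)) (hfin : S.Finite) (hS : IsDifferentialSystem S)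
    (hnorm : IsNormalized S)
    -- `S` is weakly solvable, with leading terms `lt f`
    (lt : smoothFunctions V → JetVar n m) (hlt : ∀ f ∈ S, IsOrderlySolvable lvl f (lt f))
    (hred : SatisfiesReducibility lvl S lt) :
    IsSmoothManifold (orbitZeroSet S) ∧
    -- passivity on a non-empty `V` of the form `W × ℝ^{O(lt S)}`
    ((V : Set (JetSpace n m)).Nonempty →
      (∀ z ∈ V, ∀ z' : JetSpace n m,
        (∀ t, t ∉ Sum.inr '' varOrbit (lt '' S) → z' t = z t) → z' ∈ V) →
      IsPassive S lt) ∧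
    -- passivity on an arbitrary `V` for systems polynomial in the principal variables
    ((orbitZeroSet S).Nonempty →
      (∀ f ∈ S, IsPolynomialIn (Sum.inr '' varOrbit (lt '' S)) f) →
      IsPassive S lt) := by
  obtain ⟨F, hF, hspan⟩ := exists_triangular_family hlvl hlt hred
  refine ⟨?_, fun hne hsat => ?_, fun hne hpoly => ?_⟩
  · rw [orbitZeroSet_eq_of_span_eq hspan]
    exact isSmoothManifold_of_triangular (jetRank lvl) _ F fun t ht => (hF t ht).2
  · have hV : IsSaturated V (Sum.inr '' varOrbit (lt '' S)) := hsat
    obtain ⟨h, hh, hFh⟩ := exists_normalized_generators (jetRank lvl) _ F fun t ht h hh =>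
      hV.exists_sub_mem (Set.sep_subset _ _) hh fun s hs hst =>
        (hF t ht).2 s fun hlow => hst ⟨hs, hlow⟩
    rw [hFh] at hspan
    obtain ⟨z₀, hz₀⟩ := hne
    obtain ⟨z, hz⟩ := hV.exists_common_zero ⟨z₀, hz₀⟩ hh
    exact isPassive_of_normalized_generators hlvl hlt hh hspan ⟨z₀, hz₀⟩
      (hspan ▸ span_ne_top_of_common_zero hz)
  · obtain ⟨h, hh, hFh⟩ := exists_normalized_generators (jetRank lvl) _ F fun t ht h hh => by
      refine exists_sub_mem_of_mem_adjoin hh (IsPolynomialIn.mem_adjoin ?_ fun s hs hst =>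
        (hF t ht).2 s fun hlow => hst ⟨hs, hlow⟩)
      obtain ⟨f, hf, δ, e⟩ := (hF t ht).1
      have h1 := isPolynomialIn_iff.1 ((hpoly f hf).totalDerivMulti δ)
      rw [← e] at h1
      refine isPolynomialIn_iff.2 (sub_mem h1 (Algebra.subset_adjoin (Or.inr ⟨t, ht, rfl⟩)))
    rw [hFh] at hspan
    obtain ⟨z, hz, hzS⟩ := hne
    exact isPassive_of_normalized_generators hlvl hlt hh hspan ⟨z, hz⟩
      (span_ne_top_of_common_zero hzS)
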